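/- \textbf{Notation.} Let $n,d\in\mathbb N=\{1,2,\dots\}$; cubes in $\mathbb R^n$ have edges parallel to the axes, $2^iQ$ is the cube with the same center as $Q$ and $2^i$ times its edge length, and $\|A\|$ is the operator norm of a matrix $A\in M_d(\mathbb C)$ for the Euclidean norm $|\cdot|$ of $\mathbb C^d$. A \emph{matrix weight} is a map $W:\mathbb R^n\to M_d(\mathbb C)$ with locally integrable entries whose values are nonnegative definite everywhere and invertible almost everywhere; $W^\alpha(x)=U\operatorname{diag}(\lambda_1^\alpha,\dots,\lambda_d^\alpha)U^*$ if $W(x)=U\operatorname{diag}(\lambda_1,\dots,\lambda_d)U^*$ with $U$ unitary. For $p\ge 1$ (with $p'=p/(p-1)$ if $p>1$) and cubes $Q,R$ put \[ N_{W,p}(Q,R)=\begin{cases}\operatorname*{ess\,sup}_{y\in R}\frac1{|Q|}\int_Q\|W(x)W^{-1}(y)\|\,dx, & p=1,\\[2mm] \frac1{|Q|}\int_Q\Big(\frac1{|R|}\int_R\|W^{1/p}(x)W^{-1/p}(y)\|^{p'}dy\Big)^{p/p'}dx,& p>1.\end{cases} \] A matrix weight $W$ belongs to $\mathcal A_p$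 if $\sup_Q N_{W,p}(Q,Q)<\infty$, and it has the $\mathcal A_p$-dimension $\tilde d\in\mathbb R$ if there is a constant $C$ with $N_{W,p}(Q,2^iQ)\le C2^{i\tilde d}$ for all cubes $Q$ and all $i\in\{0,1,2,\dots\}$. For $j\in\mathbb Z$, $m\in\mathbb Z^n$ let $Q_{j,m}=\prod_{i=1}^n[2^{-j}m_i,2^{-j}(m_i+1))$, and let $W(Q)=\int_Q\|W(y)\|\,dy$. For $1\le p<t<r<\infty$ or $1\le p\le t<r=\infty$, $M_p^{t,r}(W)$ is the space of all measurable $\vec f:\mathbb R^n\to\mathbb C^d$ (modulo equality almost everywhere) with $\int_K|W^{1/p}\vec f|^p\,dx<\infty$ for every compact $K$ and \[ \|\vec f\|_{M_p^{t,r}(W)}=\Big\|\Big\{W(Q_{j,m})^{1/t-1/p}\Big(\int_{Q_{j,m}}|W^{1/p}(y)\vec f(y)|^p\,dy\Big)^{1/p}\Big\}_{j\in\mathbb Z,\,m\in\mathbb Z^n}\Big\|_{\ell^r}<\infty . \] For $a\in\mathbb Z$, the dyadic average operator is \[ E_{d,a}\vec f(x)=\sum_{m\in\mathbb Z^n}\frac{\chi_{Q_{-a,m}}(x)}{|Q_{-a,m}|}\int_{Q_{-a,m}}\vec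 f(y)\,dy . \] \textbf{Theorem.} Let $1\le p<\infty$ and let $W\in\mathcal A_p$ have the $\mathcal A_p$-dimension $\tilde d\in[0,n)$. If $p=1$, put $\tilde\beta=n$. If $p>1$, let the matrix weight $W^{-1/(p-1)}$ (which belongs to $\mathcal A_{p'}$) have the $\mathcal A_{p'}$-dimension $\tilde{\tilde d}\in\mathbb R$ and put $\tilde\beta=n+\tilde{\tilde d}\,p/p'$. (i) If $p<t<r<\infty$ and $-\frac{nr}p+\frac{\tilde dr}p+n-\tilde\beta r\big(\frac1t-\frac1p\big)<0$, then for each $a\in\mathbb Z$ the operator $E_{d,a}$ is well defined and bounded on $M_p^{t,r}(W)$. (ii) If $p\le t<r=\infty$ and $\frac{\tilde d}p-\frac np-\tilde\beta\big(\frac1t-\frac1p\big)\le 0$, then for each $a\in\mathbb Z$ the operator $E_{d,a}$ is well defined and bounded on $M_p^{t,\infty}(W)$. -/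

import Mathlib

open MeasureTheory Set
open scoped ENNReal NNReal ComplexOrder

noncomputable section

namespace BourgainMorrey

/-- The half-open cube in `ℝⁿ` with edges parallel to the axes, center `c` and edge length `l`.
For `s > 0`, the dilated cube `s Q` of `Q = cube c l` is `cube c (s * l)`. -/
def cube {n : ℕ} (c : Fin n → ℝ) (l : ℝ) : Set (Fin n → ℝ) :=
  {x | ∀ i, c i - l / 2 ≤ x i ∧ x i < c i + l / 2}

/-- The dyadic cube `∏ᵢ [2⁻ʲ mᵢ, 2⁻ʲ (mᵢ + 1))`. -/
def dyadicCube {n : ℕ} (j : ℤ) (m : Fin n → ℤ) : Set (Fin n → ℝ) :=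
  {x | ∀ i, (2 : ℝ) ^ (-j) * (m i : ℝ) ≤ x i ∧ x i < (2 : ℝ) ^ (-j) * ((m i : ℝ) + 1)}

/-- Real powers of a Hermitian matrix by the functional calculus: if
`A = U diag(λ₁, …, λ_d) U*` then `matPow A α = U diag(λ₁ ^ α, …, λ_d ^ α) U*`. -/
def matPow {d : ℕ} (A : Matrix (Fin d) (Fin d) ℂ) (α : ℝ) : Matrix (Fin d) (Fin d) ℂ :=
  cfc (fun s : ℝ => s ^ α) A

theorem matPow_eq {d : ℕ} {A : Matrix (Fin d) (Fin d) ℂ} (hA : A.IsHermitian) (α : ℝ) :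
    matPow A α = (hA.eigenvectorUnitary : Matrix (Fin d) (Fin d) ℂ)
      * Matrix.diagonal (fun i => ((hA.eigenvalues i ^ α : ℝ) : ℂ))
      * star (hA.eigenvectorUnitary : Matrix (Fin d) (Fin d) ℂ) := by
  rw [matPow, hA.cfc_eq]
  rfl

/-- The matrix `A` acting on `ℂᵈ` with its Euclidean norm. -/
def act {d : ℕ} (A : Matrix (Fin d) (Fin d) ℂ) :
    EuclideanSpace ℂ (Fin d) →L[ℂ] EuclideanSpace ℂ (Fin d) :=
  Matrix.toEuclideanCLM (n := Fin d) (𝕜 := ℂ) A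

/-- The operator norm of a matrix, `sup { |A z| : |z| = 1 }`, as an extended nonnegative real. -/
def opNorm {d : ℕ} (A : Matrix (Fin d) (Fin d) ℂ) : ℝ≥0∞ := ‖act A‖ₑ

/-- Matrix weights: nonnegative definite everywhere, invertible almost everywhere, with locally
integrable entries. -/
structure IsMatrixWeight {n d : ℕ} (W : (Fin n → ℝ) → Matrix (Fin d) (Fin d) ℂ) : Prop where
  posSemidef : ∀ x, (W x).PosSemidef
  invertible : ∀ᵐ x, IsUnit (W x)
  locallyIntegrable : ∀ i j, LocallyIntegrable (fun x => W x i j) volume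

/-- For `p ≤ 1`: `ess sup_{y ∈ R} ⨍_{x ∈ Q} ‖W^{1/p}(x) W^{-1/p}(y)‖ᵖ`; for `p > 1`:
`⨍_{x ∈ Q} (⨍_{y ∈ R} ‖W^{1/p}(x) W^{-1/p}(y)‖^{p'})^{p/p'}` with `p' = p / (p - 1)`. -/
def apMean {n d : ℕ} (W : (Fin n → ℝ) → Matrix (Fin d) (Fin d) ℂ) (p : ℝ)
    (Q R : Set (Fin n → ℝ)) : ℝ≥0∞ :=
  if p ≤ 1 then
    essSup (fun y => ⨍⁻ x in Q, opNorm (matPow (W x) (1 / p) * matPow (W y) (-1 / p)) ^ p ∂volume)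
      (volume.restrict R)
  else
    ⨍⁻ x in Q, (⨍⁻ y in R, opNorm (matPow (W x) (1 / p) * matPow (W y) (-1 / p))
      ^ Real.conjExponent p ∂volume) ^ (p / Real.conjExponent p) ∂volume

/-- The class `𝒜_p` of matrix weights. -/
def IsMatrixAp {n d : ℕ} (W : (Fin n → ℝ) → Matrix (Fin d) (Fin d) ℂ) (p : ℝ) : Prop :=
  IsMatrixWeight W ∧ ∃ C : ℝ≥0, ∀ (c : Fin n → ℝ) (l : ℝ), 0 < l →
    apMean W p (cube c l) (cube c l) ≤ C

/-- The matrix weight `W` has the `𝒜_p`-dimension `D`. -/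
def HasApDimension {n d : ℕ} (W : (Fin n → ℝ) → Matrix (Fin d) (Fin d) ℂ) (p D : ℝ) : Prop :=
  IsMatrixWeight W ∧ ∃ C : ℝ≥0, ∀ (c : Fin n → ℝ) (l : ℝ), 0 < l → ∀ i : ℕ,
    apMean W p (cube c l) (cube c (2 ^ i * l)) ≤ C * ENNReal.ofReal ((2 : ℝ) ^ ((i : ℝ) * D))

/-- The dual weight `W^{-1/(p-1)}`, for `p > 1`. -/
def dualWeight {n d : ℕ} (W : (Fin n → ℝ) → Matrix (Fin d) (Fin d) ℂ) (p : ℝ) :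
    (Fin n → ℝ) → Matrix (Fin d) (Fin d) ℂ :=
  fun x => matPow (W x) (-1 / (p - 1))

/-- The exponent `β̃`; `D'` is the `𝒜_{p'}`-dimension of the dual weight, used for `p > 1`. -/
def betaTilde (n : ℕ) (p D' : ℝ) : ℝ :=
  if p = 1 then n else n + D' * p / Real.conjExponent p

/-- `∫_E |W^{1/p}(x) f(x)|ᵖ dx`. -/
def weightedIntegral {n d : ℕ} (W : (Fin n → ℝ) → Matrix (Fin d) (Fin d) ℂ) (p : ℝ)
    (f : (Fin n → ℝ) → EuclideanSpace ℂ (Fin d)) (E : Set (Fin n → ℝ)) : ℝ≥0∞ :=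
  ∫⁻ x in E, ‖act (matPow (W x) (1 / p)) (f x)‖ₑ ^ p

/-- `L^p_loc(W)`. -/
def LpLoc {n d : ℕ} (W : (Fin n → ℝ) → Matrix (Fin d) (Fin d) ℂ) (p : ℝ) :
    Set ((Fin n → ℝ) → EuclideanSpace ℂ (Fin d)) :=
  {f | AEStronglyMeasurable f volume ∧ ∀ K, IsCompact K → weightedIntegral W p f K < ∞}

/-- `W(E) = ∫_E ‖W(y)‖ dy`. -/
def weightMass {n d : ℕ} (W : (Fin n → ℝ) → Matrix (Fin d) (Fin d) ℂ)
    (E : Set (Fin n → ℝ)) : ℝ≥0∞ :=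
  ∫⁻ y in E, opNorm (W y)

/-- The `ℓ^r` norm of a family of extended nonnegative reals, `0 < r ≤ ∞`. -/
def lrNorm {ι : Type*} (r : ℝ≥0∞) (u : ι → ℝ≥0∞) : ℝ≥0∞ :=
  if r = ∞ then ⨆ i, u i else (∑' i, u i ^ r.toReal) ^ (1 / r.toReal)

/-- The norm of the matrix weighted Bourgain-Morrey space `M_p^{t,r}(W)`. -/
def bmNorm {n d : ℕ} (W : (Fin n → ℝ) → Matrix (Fin d) (Fin d) ℂ) (p t : ℝ) (r : ℝ≥0∞)
    (f : (Fin n → ℝ) → EuclideanSpace ℂ (Fin d)) : ℝ≥0∞ :=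
  lrNorm r fun q : ℤ × (Fin n → ℤ) =>
    weightMass W (dyadicCube q.1 q.2) ^ (1 / t - 1 / p)
      * weightedIntegral W p f (dyadicCube q.1 q.2) ^ (1 / p)

/-- The matrix weighted Bourgain-Morrey space `M_p^{t,r}(W)`. -/
def bmSpace {n d : ℕ} (W : (Fin n → ℝ) → Matrix (Fin d) (Fin d) ℂ) (p t : ℝ) (r : ℝ≥0∞) :
    Set ((Fin n → ℝ) → EuclideanSpace ℂ (Fin d)) :=
  {f | f ∈ LpLoc W p ∧ bmNorm W p t r f < ∞}

/-- The dyadic average operator `E_{d,a}`, averaging over the dyadic cubes of edge length `2ᵃ`. -/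
def dyadicAverage {n d : ℕ} (a : ℤ) (f : (Fin n → ℝ) → EuclideanSpace ℂ (Fin d)) :
    (Fin n → ℝ) → EuclideanSpace ℂ (Fin d) :=
  fun x => ∑' m : Fin n → ℤ,
    (dyadicCube (-a) m).indicator (fun _ => ⨍ y in dyadicCube (-a) m, f y) x

/-- `E_{d,a}` is a bounded operator on `M_p^{t,r}(W)`: the averages of each function of the space
exist, and `E_{d,a}` is a well-defined linear map of the space (modulo equality almost everywhere)
into itself which is bounded for its norm. -/
structure DyadicAverageBounded {n d : ℕ} (W : (Fin n → ℝ) → Matrix (Fin d) (Fin d) ℂ) (p t : ℝ)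
    (r : ℝ≥0∞) (a : ℤ) : Prop where
  integrableOn : ∀ f ∈ bmSpace W p t r, ∀ m, IntegrableOn f (dyadicCube (-a) m)
  mapsTo : ∀ f ∈ bmSpace W p t r, dyadicAverage a f ∈ bmSpace W p t r
  congr_ae : ∀ f ∈ bmSpace W p t r, ∀ g ∈ bmSpace W p t r, f =ᵐ[volume] g →
    dyadicAverage a f =ᵐ[volume] dyadicAverage a g
  map_add : ∀ f ∈ bmSpace W p t r, ∀ g ∈ bmSpace W p t r,
    dyadicAverage a (f + g) =ᵐ[volume] dyadicAverage a f + dyadicAverage a g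
  map_smul : ∀ (z : ℂ), ∀ f ∈ bmSpace W p t r,
    dyadicAverage a (z • f) =ᵐ[volume] z • dyadicAverage a f
  bound : ∃ C : ℝ≥0, ∀ f ∈ bmSpace W p t r,
    bmNorm W p t r (dyadicAverage a f) ≤ C * bmNorm W p t r f

end BourgainMorrey

end

/-!
Write `A = W^{1/p}` and `B = W^{-1/p}`, so that `A B = 1` almost everywhere. Two facts about cubes
carry the proof.

*Averages.* From `|A(x) ⨍_P f| ≤ ⨍_P ‖A(x) B(y)‖ |A(y) f(y)| dy`, Hölder's inequality (Tonelli's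
theorem if `p = 1`) gives
`∫_Q |A ⨍_P f|ᵖ ≤ (|Q| / |P|) * apMean W p Q P * ∫_P |A f|ᵖ` (`weightedIntegral_average_le`). If `P`
is the dyadic ancestor of `Q`, `k` generations up, then `P` lies in the concentric dilate of `Q` by
`2 ^ (k + 1)`, and the `𝒜_p`-dimension `D` turns the factor into a multiple of `2 ^ (k (D - n))`.

*Doubling.* `W(P) ≤ C 2 ^ (k β̃) W(Q)` for the same cubes (`exists_weightMass_ancestor_le`). For
`p = 1` this follows from `⨍_R ‖W‖ ≤ C ‖W(x)‖` for almost every `x` in a cube `R`. For `p > 1`, one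
has `⨍_R ‖W‖ ≤ (⨍_R ‖B(x) A(y)‖ᵖ dy) ‖W(x)‖` for almost every `x`; taking `p`-th roots and averaging
over `x ∈ Q` with Hölder's inequality bounds `⨍_R ‖W‖ / ⨍_Q ‖W‖` by a power of the `𝒜_{p'}` mean of
the dual weight.

Consequently the term of the `M_p^{t,r}(W)` norm of `E_{d,a} f` at a cube `Q` of edge length at
least `2ᵃ` is dominated by the term of `f` at `Q`, because `Q` is a union of averaging cubes, and
the term at a cube `k` generations below an averaging cube `P` is at most `C 2 ^ (k γ)` times the
term of `f` at `P`, where `γ = (D - n) / p - β̃ (1/t - 1/p)` (`exists_bmTerm_dyadicAverage_le`).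
Each averaging cube has `2 ^ (k n)` such descendants, so the `ℓ^r` norms are comparable as soon as
the geometric series of ratio `2 ^ (γ r + n)` converges, or `γ ≤ 0` if `r = ∞`
(`exists_lrNorm_le`, `exists_lrNorm_top_le`); these are the two hypotheses on the exponents.

Local integrability of `f` also comes from the kernel estimate: it makes
`⨍_P ‖A(x) B(y)‖ |A(y) f(y)| dy` finite for almost every `x ∈ P`, hence at some `x` where `W x` is
invertible.
-/

namespace BourgainMorrey

/-! ### Powers and operator norms of positive matrices -/

section Matrix

variable {d : ℕ} {A B : Matrix (Fin d) (Fin d) ℂ}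

theorem act_mul (A B : Matrix (Fin d) (Fin d) ℂ) : act (A * B) = act A * act B :=
  map_mul (Matrix.toEuclideanCLM (n := Fin d) (𝕜 := ℂ)) A B

theorem act_one : act (1 : Matrix (Fin d) (Fin d) ℂ) = 1 :=
  map_one (Matrix.toEuclideanCLM (n := Fin d) (𝕜 := ℂ))

theorem continuous_act : Continuous (act (d := d)) :=
  LinearMap.continuous_of_finiteDimensional
    (Matrix.toEuclideanCLM (n := Fin d) (𝕜 := ℂ)).toAlgEquiv.toLinearMap

theorem opNorm_mul_le (A B : Matrix (Fin d) (Fin d) ℂ) :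
    opNorm (A * B) ≤ opNorm A * opNorm B := by
  simp only [opNorm, act_mul]
  simp only [enorm_eq_nnnorm]
  exact_mod_cast nnnorm_mul_le (act A) (act B)

theorem opNorm_mul_comm (hA : A.IsHermitian) (hB : B.IsHermitian) :
    opNorm (A * B) = opNorm (B * A) := by
  have h : act (B * A) = star (act (A * B)) := by
    have : B * A = star (A * B) := by
      rw [star_mul, Matrix.star_eq_conjTranspose, Matrix.star_eq_conjTranspose, hA.eq, hB.eq]
    rw [this]
    exact map_star (Matrix.toEuclideanCLM (n := Fin d) (𝕜 := ℂ)) _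
  have h1 : ‖act (B * A)‖₊ = ‖act (A * B)‖₊ := by
    rw [h]
    exact nnnorm_star (act (A * B))
  exact congrArg ENNReal.ofNNReal h1.symm

theorem opNorm_lt_top (A : Matrix (Fin d) (Fin d) ℂ) : opNorm A < ∞ := enorm_lt_top

theorem isHermitian_matPow (A : Matrix (Fin d) (Fin d) ℂ) (α : ℝ) : (matPow A α).IsHermitian :=
  cfc_predicate (p := IsSelfAdjoint) _ A

theorem continuousOn_spectrum (A : Matrix (Fin d) (Fin d) ℂ) (f : ℝ → ℝ) :
    ContinuousOn f (spectrum ℝ A) :=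
  (Matrix.finite_real_spectrum (A := A)).continuousOn f

theorem spectrum_nonneg (hA : A.PosSemidef) {s : ℝ} (hs : s ∈ spectrum ℝ A) : 0 ≤ s := by
  rw [hA.isHermitian.spectrum_real_eq_range_eigenvalues] at hs
  obtain ⟨i, rfl⟩ := hs
  exact hA.eigenvalues_nonneg i

theorem spectrum_pos (hA : A.PosSemidef) (hu : IsUnit A) {s : ℝ} (hs : s ∈ spectrum ℝ A) :
    0 < s := by
  refine lt_of_le_of_ne (spectrum_nonneg hA hs) ?_
  rintro rfl
  exact (spectrum.zero_notMem_iff ℝ).2 hu hs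

theorem opNorm_matPow (hA : A.PosSemidef) {α : ℝ} (hα : 0 < α) :
    opNorm (matPow A α) = opNorm A ^ α := by
  open scoped Matrix.Norms.L2Operator MatrixOrder in
  have h0 : 0 ≤ A := Matrix.nonneg_iff_posSemidef.2 hA
  open scoped Matrix.Norms.L2Operator MatrixOrder in
  have h : ‖matPow A α‖₊ = ‖A‖₊ ^ α := by
    rw [← CFC.nnnorm_rpow A hα h0, CFC.rpow_eq_cfc_real h0]
    rfl
  have h1 : opNorm (matPow A α) = ((‖act (matPow A α)‖₊ : ℝ≥0) : ℝ≥0∞) := rfl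
  have h2 : opNorm A = ((‖act A‖₊ : ℝ≥0) : ℝ≥0∞) := rfl
  rw [h1, h2, ← ENNReal.coe_rpow_of_nonneg _ hα.le]
  exact congrArg _ h

theorem matPow_mul_matPow_neg (hA : A.PosSemidef) (hu : IsUnit A) (α : ℝ) :
    matPow A α * matPow A (-α) = 1 := by
  rw [matPow, matPow, ← cfc_mul _ _ A (continuousOn_spectrum A _) (continuousOn_spectrum A _)]
  refine (cfc_congr (g := fun _ => (1 : ℝ)) ?_).trans (cfc_const_one ℝ A hA.isHermitian)
  intro s hs
  have := spectrum_pos hA hu hs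
  simp only
  rw [← Real.rpow_add this, add_neg_cancel, Real.rpow_zero]

theorem matPow_matPow (hA : A.PosSemidef) (α β : ℝ) :
    matPow (matPow A α) β = matPow A (α * β) := by
  refine (cfc_comp' (fun s : ℝ => s ^ β) (fun s : ℝ => s ^ α) A ?_ (continuousOn_spectrum A _)
    hA.isHermitian).symm.trans ?_
  · exact ((Matrix.finite_real_spectrum (A := A)).image _).continuousOn _
  · refine cfc_congr fun s hs => ?_
    rw [Real.rpow_mul (spectrum_nonneg hA hs)]

/-- For a function continuous on the whole line the functional calculus is continuous on the
Hermitian matrices; composing with the Hermitian part makes it continuous on all matrices. -/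
theorem continuous_cfc_hermitianPart (f : ℝ → ℝ) (hf : Continuous f) :
    Continuous fun M : Matrix (Fin d) (Fin d) ℂ => cfc f ((2⁻¹ : ℂ) • (M + M.conjTranspose)) := by
  open scoped Matrix.Norms.L2Operator in
  refine Continuous.cfc_of_mem_nhdsSet (s := univ) f Filter.univ_mem ?_ ?_ hf.continuousOn
  · have hid : Continuous fun M : Matrix (Fin d) (Fin d) ℂ => M := continuous_id
    exact (hid.add hid.matrix_conjTranspose).const_smul (2⁻¹ : ℂ)
  · intro M
    change star _ = _
    rw [Matrix.star_eq_conjTranspose, Matrix.conjTranspose_smul, Matrix.conjTranspose_add,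
      Matrix.conjTranspose_conjTranspose, add_comm]
    simp

end Matrix

/-! ### Measurability of the powers of a matrix weight -/

section Measurability

open Filter Topology

variable {n d : ℕ} {W : (Fin n → ℝ) → Matrix (Fin d) (Fin d) ℂ}

theorem IsMatrixWeight.aestronglyMeasurable (hW : IsMatrixWeight W) :
    AEStronglyMeasurable W volume := by
  have h : W = fun x => ∑ i, ∑ j, W x i j • Matrix.single i j (1 : ℂ) := by
    ext1 x
    conv_lhs => rw [Matrix.matrix_eq_sum_single (W x)]
    simp [Matrix.smul_single]
  rw [h]
  refine Finset.aestronglyMeasurable_fun_sum _ fun i _ =>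
    Finset.aestronglyMeasurable_fun_sum _ fun j _ => ?_
  exact (hW.locallyIntegrable i j).aestronglyMeasurable.smul_const _

/-- A power `s ↦ s ^ α` may be discontinuous at `0`, so the functional calculus of it is obtained
as a limit of that of the continuous functions `s ↦ (max s (k + 1)⁻¹) ^ α`; at an invertible matrix
these are eventually equal to it on the spectrum. -/
theorem IsMatrixWeight.aestronglyMeasurable_matPow (hW : IsMatrixWeight W) (α : ℝ) :
    AEStronglyMeasurable (fun x => matPow (W x) α) volume := by
  have hpos (k : ℕ) (s : ℝ) : 0 < max s ((k : ℝ) + 1)⁻¹ :=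
    lt_max_of_lt_right (by positivity)
  have : TopologicalSpace.PseudoMetrizableSpace (Matrix (Fin d) (Fin d) ℂ) :=
    inferInstanceAs (TopologicalSpace.PseudoMetrizableSpace (Fin d → Fin d → ℂ))
  refine aestronglyMeasurable_of_tendsto_ae atTop
    (f := fun (k : ℕ) x => cfc (fun s : ℝ => max s ((k : ℝ) + 1)⁻¹ ^ α)
      ((2⁻¹ : ℂ) • (W x + (W x).conjTranspose))) (fun k => ?_) ?_
  · refine (continuous_cfc_hermitianPart _ ?_).comp_aestronglyMeasurable hW.aestronglyMeasurable
    exact (continuous_id.max continuous_const).rpow_const fun s => Or.inl (hpos k s).ne'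
  · filter_upwards [hW.invertible] with x hx
    have hherm : (2⁻¹ : ℂ) • (W x + (W x).conjTranspose) = W x := by
      rw [(hW.posSemidef x).isHermitian.eq, ← two_smul ℂ (W x), smul_smul]
      norm_num
    rw [hherm]
    refine tendsto_const_nhds.congr' ?_
    have hev : ∀ s ∈ spectrum ℝ (W x), ∀ᶠ k : ℕ in atTop, ((k : ℝ) + 1)⁻¹ ≤ s := by
      intro s hs
      have hs0 := spectrum_pos (hW.posSemidef x) hx hs
      have := tendsto_one_div_add_atTop_nhds_zero_nat (𝕜 := ℝ)
      filter_upwards [this.eventually (gt_mem_nhds hs0)] with k hk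
      simpa using hk.le
    have := (Matrix.finite_real_spectrum (A := W x)).eventually_all.2 hev
    filter_upwards [this] with k hk
    refine cfc_congr fun s hs => ?_
    simp only [max_eq_left (hk s hs)]

theorem IsMatrixWeight.aestronglyMeasurable_act_matPow (hW : IsMatrixWeight W) (α : ℝ) :
    AEStronglyMeasurable (fun x => act (matPow (W x) α)) volume :=
  continuous_act.comp_aestronglyMeasurable (hW.aestronglyMeasurable_matPow α)

theorem IsMatrixWeight.aemeasurable_opNorm (hW : IsMatrixWeight W) :
    AEMeasurable (fun x => opNorm (W x)) volume :=
  (continuous_act.comp_aestronglyMeasurable hW.aestronglyMeasurable).enorm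

theorem IsMatrixWeight.aemeasurable_opNorm_mul (hW : IsMatrixWeight W) (α β : ℝ)
    {μ ν : Measure (Fin n → ℝ)} [SFinite μ] [SFinite ν] (hμ : μ ≪ volume) (hν : ν ≪ volume) :
    AEMeasurable (fun z : (Fin n → ℝ) × (Fin n → ℝ) =>
      opNorm (matPow (W z.1) α * matPow (W z.2) β)) (μ.prod ν) := by
  have h1 := ((hW.aestronglyMeasurable_act_matPow α).mono_ac hμ).comp_quasiMeasurePreserving
    (Measure.quasiMeasurePreserving_fst (μ := μ) (ν := ν))
  have h2 := ((hW.aestronglyMeasurable_act_matPow β).mono_ac hν).comp_quasiMeasurePreserving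
    (Measure.quasiMeasurePreserving_snd (μ := μ) (ν := ν))
  refine AEMeasurable.congr (h1.mul h2).enorm (ae_of_all _ fun z => ?_)
  simp only [opNorm, act_mul]
  rfl

theorem IsMatrixWeight.aemeasurable_enorm_act (hW : IsMatrixWeight W) (α : ℝ)
    {f : (Fin n → ℝ) → EuclideanSpace ℂ (Fin d)} (hf : AEStronglyMeasurable f volume) :
    AEMeasurable (fun x => ‖act (matPow (W x) α) (f x)‖ₑ) volume :=
  (isBoundedBilinearMap_apply.continuous.comp_aestronglyMeasurable
    ((hW.aestronglyMeasurable_act_matPow α).prodMk hf)).enorm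

theorem IsMatrixWeight.matPow_mul_matPow_neg (hW : IsMatrixWeight W) (α : ℝ) :
    ∀ᵐ x, matPow (W x) α * matPow (W x) (-α) = 1 := by
  filter_upwards [hW.invertible] with x hx
  exact BourgainMorrey.matPow_mul_matPow_neg (hW.posSemidef x) hx α

theorem IsMatrixWeight.matPow_neg_mul_matPow (hW : IsMatrixWeight W) (α : ℝ) :
    ∀ᵐ x, matPow (W x) (-α) * matPow (W x) α = 1 := by
  simpa using hW.matPow_mul_matPow_neg (-α)

end Measurability

/-! ### Integral operators with a mixed norm kernel bound -/

section Kernel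

variable {α β : Type*} [MeasurableSpace α] [MeasurableSpace β] {μ : Measure α} {ν : Measure β}

theorem lintegral_rpow_lintegral_mul_le {p : ℝ} (hp : 1 < p) {k : α → β → ℝ≥0∞} {g : β → ℝ≥0∞}
    (hk : ∀ x, AEMeasurable (k x) ν) (hg : AEMeasurable g ν) (hfin : ∫⁻ y, g y ^ p ∂ν ≠ ∞) :
    ∫⁻ x, (∫⁻ y, k x y * g y ∂ν) ^ p ∂μ
      ≤ (∫⁻ x, (∫⁻ y, k x y ^ Real.conjExponent p ∂ν) ^ (p / Real.conjExponent p) ∂μ)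
        * ∫⁻ y, g y ^ p ∂ν := by
  have hpq : p.HolderConjugate p.conjExponent := Real.HolderConjugate.conjExponent hp
  rw [← lintegral_mul_const' _ _ hfin]
  refine lintegral_mono fun x => ?_
  calc (∫⁻ y, k x y * g y ∂ν) ^ p
      ≤ ((∫⁻ y, k x y ^ p.conjExponent ∂ν) ^ (1 / p.conjExponent)
          * (∫⁻ y, g y ^ p ∂ν) ^ (1 / p)) ^ p :=
        ENNReal.rpow_le_rpow (ENNReal.lintegral_mul_le_Lp_mul_Lq ν hpq.symm (hk x) hg)
          hpq.nonneg
    _ = _ := by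
        rw [ENNReal.mul_rpow_of_nonneg _ _ hpq.nonneg, ← ENNReal.rpow_mul, ← ENNReal.rpow_mul,
          one_div_mul_cancel hpq.ne_zero, ENNReal.rpow_one]
        congr 2
        ring

theorem lintegral_lintegral_mul_le_essSup [SFinite μ] [SFinite ν] {k : α → β → ℝ≥0∞}
    {g : β → ℝ≥0∞} (hk : AEMeasurable (Function.uncurry k) (μ.prod ν)) (hg : AEMeasurable g ν) :
    ∫⁻ x, ∫⁻ y, k x y * g y ∂ν ∂μ ≤ essSup (fun y => ∫⁻ x, k x y ∂μ) ν * ∫⁻ y, g y ∂ν := by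
  have hkg : AEMeasurable (Function.uncurry fun x y => k x y * g y) (μ.prod ν) :=
    hk.mul (hg.comp_quasiMeasurePreserving Measure.quasiMeasurePreserving_snd)
  rw [lintegral_lintegral_swap hkg, ← lintegral_const_mul'' _ hg]
  refine lintegral_mono_ae ?_
  have hk' : ∀ᵐ y ∂ν, AEMeasurable (fun x => k x y) μ :=
    hk.aestronglyMeasurable.prodMk_right.mono fun y hy => hy.aemeasurable
  filter_upwards [ENNReal.ae_le_essSup (μ := ν) fun y => ∫⁻ x, k x y ∂μ, hk'] with y hy hky
  rw [lintegral_mul_const'' _ hky]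
  gcongr

end Kernel

/-! ### Averages over sets and the quantity `apMean` -/

section Average

variable {n d : ℕ} {W : (Fin n → ℝ) → Matrix (Fin d) (Fin d) ℂ} {p : ℝ}
  {P Q R : Set (Fin n → ℝ)}

theorem smul_restrict_absolutelyContinuous (c : ℝ≥0∞) (P : Set (Fin n → ℝ)) :
    c • (volume : Measure (Fin n → ℝ)).restrict P ≪ volume :=
  Measure.smul_absolutelyContinuous.trans Measure.restrict_le_self.absolutelyContinuous

theorem apMean_eq_of_one_lt (hp : 1 < p) (Q R : Set (Fin n → ℝ)) :
    apMean W p Q R = ⨍⁻ x in Q, (⨍⁻ y in R, opNorm (matPow (W x) (1 / p) * matPow (W y) (-1 / p))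
      ^ Real.conjExponent p ∂volume) ^ (p / Real.conjExponent p) ∂volume := by
  rw [apMean, if_neg (not_le.2 hp)]

theorem apMean_one (Q R : Set (Fin n → ℝ)) :
    apMean W 1 Q R = essSup (fun y => ⨍⁻ x in Q, opNorm (matPow (W x) (1 / 1)
      * matPow (W y) (-1 / 1)) ∂volume) (volume.restrict R) := by
  simp [apMean]

/-- `apMean W p Q R` bounds the `L^p` norm, from `R` to `Q`, of the integral operator with kernel
`‖W^{1/p}(x) W^{-1/p}(y)‖`: Hölder's inequality in `y` for `p > 1`, Tonelli's theorem for
`p = 1`. -/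
theorem laverage_rpow_laverage_opNorm_mul_le (hp : 1 ≤ p) (hW : IsMatrixWeight W)
    (hRtop : volume R ≠ ∞) (hQtop : volume Q ≠ ∞)
    {g : (Fin n → ℝ) → ℝ≥0∞} (hg : AEMeasurable g volume) (hfin : ∫⁻ y in R, g y ^ p ≠ ∞) :
    ⨍⁻ x in Q, (⨍⁻ y in R, opNorm (matPow (W x) (1 / p) * matPow (W y) (-1 / p)) * g y ∂volume) ^ p
        ∂volume
      ≤ apMean W p Q R * ⨍⁻ y in R, g y ^ p ∂volume := by
  have : IsFiniteMeasure (volume.restrict R) := ⟨by simpa using hRtop.lt_top⟩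
  have : IsFiniteMeasure (volume.restrict Q) := ⟨by simpa using hQtop.lt_top⟩
  have hν := smul_restrict_absolutelyContinuous ((volume.restrict R) univ)⁻¹ R
  have hμ := smul_restrict_absolutelyContinuous ((volume.restrict Q) univ)⁻¹ Q
  rcases hp.eq_or_lt with rfl | hp
  · rw [apMean_one]
    have hsup : essSup (fun y => ⨍⁻ x in Q, opNorm (matPow (W x) (1 / 1)
        * matPow (W y) (-1 / 1)) ∂volume) (((volume.restrict R) univ)⁻¹ • volume.restrict R)
        ≤ essSup (fun y => ⨍⁻ x in Q, opNorm (matPow (W x) (1 / 1)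
        * matPow (W y) (-1 / 1)) ∂volume) (volume.restrict R) :=
      essSup_mono_measure Measure.smul_absolutelyContinuous
    refine le_trans ?_ (mul_le_mul_left hsup _)
    simp only [ENNReal.rpow_one]
    exact lintegral_lintegral_mul_le_essSup (hW.aemeasurable_opNorm_mul _ _ hμ hν)
      (hg.mono_ac hν)
  · rw [apMean_eq_of_one_lt hp]
    refine lintegral_rpow_lintegral_mul_le hp (fun x => ?_) (hg.mono_ac hν) ?_
    · have h := (hW.aestronglyMeasurable_act_matPow (-1 / p)).mono_ac hν
      refine AEMeasurable.congr (h.const_mul (act (matPow (W x) (1 / p)))).enorm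
        (ae_of_all _ fun z => ?_)
      simp only [opNorm, act_mul]
    · exact (laverage_lt_top hfin).ne

/-- Pointwise, `|W^{1/p}(x) ⨍ f| ≤ ⨍ ‖W^{1/p}(x) W^{-1/p}(y)‖ |W^{1/p}(y) f(y)| dy`. -/
theorem enorm_act_average_le (hW : IsMatrixWeight W) (f : (Fin n → ℝ) → EuclideanSpace ℂ (Fin d))
    (hf : IntegrableOn f P) (x : Fin n → ℝ) :
    ‖act (matPow (W x) (1 / p)) (⨍ y in P, f y)‖ₑ
      ≤ ⨍⁻ y in P, opNorm (matPow (W x) (1 / p) * matPow (W y) (-1 / p))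
          * ‖act (matPow (W y) (1 / p)) (f y)‖ₑ ∂volume := by
  have hν := smul_restrict_absolutelyContinuous ((volume.restrict P) univ)⁻¹ P
  have hint : Integrable f (((volume.restrict P) univ)⁻¹ • volume.restrict P) :=
    Integrable.to_average hf
  have h1 : act (matPow (W x) (1 / p)) (⨍ y in P, f y)
      = ⨍ y in P, act (matPow (W x) (1 / p)) (f y) :=
    (ContinuousLinearMap.integral_comp_comm _ hint).symm
  rw [h1]
  refine (enorm_integral_le_lintegral_enorm _).trans (lintegral_mono_ae ?_)
  filter_upwards [hν (hW.matPow_neg_mul_matPow (1 / p))] with y hy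
  have h2 : act (matPow (W x) (1 / p)) (f y)
      = act (matPow (W x) (1 / p) * matPow (W y) (-1 / p))
        (act (matPow (W y) (1 / p)) (f y)) := by
    rw [← mul_apply_eq_comp, ← act_mul, mul_assoc, neg_div, hy, mul_one]
  rw [h2]
  exact ContinuousLinearMap.le_opENorm _ _

theorem setLAverage_average_le (hp : 1 ≤ p) (hW : IsMatrixWeight W)
    (hPtop : volume P ≠ ∞) (hQtop : volume Q ≠ ∞)
    {f : (Fin n → ℝ) → EuclideanSpace ℂ (Fin d)} (hf : AEStronglyMeasurable f volume)
    (hint : IntegrableOn f P) (hfin : weightedIntegral W p f P ≠ ∞) :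
    ⨍⁻ x in Q, ‖act (matPow (W x) (1 / p)) (⨍ y in P, f y)‖ₑ ^ p ∂volume
      ≤ apMean W p Q P * ⨍⁻ x in P, ‖act (matPow (W x) (1 / p)) (f x)‖ₑ ^ p ∂volume := by
  refine le_trans (lintegral_mono fun x => ?_)
    (laverage_rpow_laverage_opNorm_mul_le hp hW hPtop hQtop
      (hW.aemeasurable_enorm_act (1 / p) hf) hfin)
  exact ENNReal.rpow_le_rpow (enorm_act_average_le hW f hint x) (by linarith)

theorem weightedIntegral_average_le (hp : 1 ≤ p) (hW : IsMatrixWeight W)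
    (hPtop : volume P ≠ ∞) (hQtop : volume Q ≠ ∞)
    {f : (Fin n → ℝ) → EuclideanSpace ℂ (Fin d)} (hf : AEStronglyMeasurable f volume)
    (hint : IntegrableOn f P) (hfin : weightedIntegral W p f P ≠ ∞) :
    weightedIntegral W p (fun _ => ⨍ y in P, f y) Q
      ≤ volume Q / volume P * apMean W p Q P * weightedIntegral W p f P := by
  have h := setLAverage_average_le hp hW hPtop hQtop hf hint hfin
  rw [weightedIntegral, ← measure_mul_setLAverage _ hQtop]
  refine (mul_le_mul_right h _).trans (le_of_eq ?_)
  rw [setLAverage_eq, weightedIntegral]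
  simp only [div_eq_mul_inv]
  ring

/-- Finiteness of `apMean W p P P` makes the kernel integral finite for almost every `x ∈ P`; one
such `x` at which `W x` is invertible bounds the integral of `|f|`. -/
theorem integrableOn_of_apMean_ne_top (hp : 1 ≤ p) (hW : IsMatrixWeight W)
    (hP0 : volume P ≠ 0) (hPtop : volume P ≠ ∞) (hA : apMean W p P P ≠ ∞)
    {f : (Fin n → ℝ) → EuclideanSpace ℂ (Fin d)} (hf : AEStronglyMeasurable f volume)
    (hfin : weightedIntegral W p f P ≠ ∞) : IntegrableOn f P := by
  have : IsFiniteMeasure (volume.restrict P) := ⟨by simpa using hPtop.lt_top⟩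
  have : NeZero (volume.restrict P) := ⟨by simpa using hP0⟩
  set ν := ((volume.restrict P) univ)⁻¹ • volume.restrict P with hνdef
  have hν : ν ≪ volume := smul_restrict_absolutelyContinuous ((volume.restrict P) univ)⁻¹ P
  have hg := (hW.aemeasurable_enorm_act (1 / p) hf)
  have h := laverage_rpow_laverage_opNorm_mul_le hp hW hPtop hPtop hg hfin
  have hlt : ∫⁻ x, (∫⁻ y, opNorm (matPow (W x) (1 / p) * matPow (W y) (-1 / p))
      * ‖act (matPow (W y) (1 / p)) (f y)‖ₑ ∂ν) ^ p ∂ν < ∞ :=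
    h.trans_lt (ENNReal.mul_lt_top hA.lt_top (laverage_lt_top hfin))
  have hmeas : AEMeasurable (fun x => ∫⁻ y, opNorm (matPow (W x) (1 / p) * matPow (W y) (-1 / p))
      * ‖act (matPow (W y) (1 / p)) (f y)‖ₑ ∂ν) ν :=
    ((hW.aemeasurable_opNorm_mul _ _ hν hν).mul ((hg.mono_ac hν).comp_quasiMeasurePreserving
      Measure.quasiMeasurePreserving_snd)).lintegral_prod_right'
  have hae := ae_lt_top' (hmeas.pow_const p) hlt.ne
  obtain ⟨x, hx, hxinv⟩ := (hae.and (hν (hW.matPow_neg_mul_matPow (1 / p)))).exists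
  have hx' := (ENNReal.rpow_lt_top_iff_of_pos (by linarith)).1 hx
  refine ⟨hf.restrict, ?_⟩
  have hνint : ∫⁻ y, ‖f y‖ₑ ∂ν < ∞ := by
    refine lt_of_le_of_lt (lintegral_mono_ae (g := fun y => opNorm (matPow (W x) (-1 / p)) *
      (opNorm (matPow (W x) (1 / p) * matPow (W y) (-1 / p))
        * ‖act (matPow (W y) (1 / p)) (f y)‖ₑ)) ?_) ?_
    · filter_upwards [hν (hW.matPow_neg_mul_matPow (1 / p))] with y hy
      have h2 : f y = act (matPow (W x) (-1 / p))
          (act (matPow (W x) (1 / p) * matPow (W y) (-1 / p))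
            (act (matPow (W y) (1 / p)) (f y))) := by
        rw [← mul_apply_eq_comp, ← mul_apply_eq_comp, ← act_mul, ← act_mul, mul_assoc,
          mul_assoc, neg_div, hy, mul_one, hxinv, act_one]
        rfl
      conv_lhs => rw [h2]
      exact (ContinuousLinearMap.le_opENorm _ _).trans
        (mul_le_mul_right (ContinuousLinearMap.le_opENorm _ _) _)
    · rw [lintegral_const_mul' _ _ (opNorm_lt_top _).ne]
      exact ENNReal.mul_lt_top (opNorm_lt_top _) hx'
  rw [hνdef, lintegral_smul_measure] at hνint
  rw [HasFiniteIntegral]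
  refine ENNReal.lt_top_of_mul_ne_top_right hνint.ne ?_
  simpa using hPtop

/-! ### Comparison of the masses of two sets -/

/-- For `p = 1`, `⨍_R ‖W‖ ≤ (⨍_R ‖W(x) W⁻¹(y)‖ dx) ‖W(y)‖` for almost every `y ∈ R`, which is then
averaged over `y ∈ Q`. -/
theorem laverage_opNorm_le_of_one (hW : IsMatrixWeight W) (hQR : Q ⊆ R)
    (hQ0 : volume Q ≠ 0) (hQtop : volume Q ≠ ∞) :
    ⨍⁻ y in R, opNorm (W y) ∂volume ≤ apMean W 1 R R * ⨍⁻ y in Q, opNorm (W y) ∂volume := by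
  have : IsFiniteMeasure (volume.restrict Q) := ⟨by simpa using hQtop.lt_top⟩
  have : NeZero (volume.restrict Q) := ⟨by simpa using hQ0⟩
  have hμ := smul_restrict_absolutelyContinuous ((volume.restrict Q) univ)⁻¹ Q
  rw [apMean_one, ← laverage_const (volume.restrict Q) (⨍⁻ y in R, opNorm (W y) ∂volume)]
  have hμR : ((volume.restrict Q) univ)⁻¹ • volume.restrict Q ≪ volume.restrict R :=
    Measure.smul_absolutelyContinuous.trans
      (Measure.absolutelyContinuous_of_le (Measure.restrict_mono_set _ hQR))
  have hw : AEMeasurable (fun y => opNorm (W y))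
    (((volume.restrict Q) univ)⁻¹ • volume.restrict Q) := hW.aemeasurable_opNorm.mono_ac hμ
  refine le_trans (lintegral_mono_ae ?_) (lintegral_const_mul'' _ hw).le
  have hone (x) : matPow (W x) (1 / 1) = W x := by
    rw [matPow]
    simp only [div_one, Real.rpow_one]
    exact cfc_id' ℝ (W x) (hW.posSemidef x).isHermitian
  filter_upwards [hμR (ENNReal.ae_le_essSup (μ := volume.restrict R) fun y =>
      ⨍⁻ x in R, opNorm (matPow (W x) (1 / 1) * matPow (W y) (-1 / 1)) ∂volume),
    hμ (hW.matPow_neg_mul_matPow (1 / 1))] with y hy hinv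
  refine le_trans ?_ (mul_le_mul_left hy _)
  rw [laverage, laverage, ← lintegral_mul_const' _ _ (opNorm_lt_top _).ne]
  refine lintegral_mono fun x => ?_
  refine le_trans (le_of_eq ?_) (opNorm_mul_le _ _)
  rw [hone y] at hinv
  rw [mul_assoc, neg_div, hinv, mul_one, hone]

/-- For `p > 1`, `⨍_R ‖W‖ ≤ K(x) ‖W(x)‖` with `K(x) = ⨍_R ‖W^{-1/p}(x) W^{1/p}(y)‖ᵖ dy`; taking
`p`-th roots, averaging over `x ∈ Q` and applying Hölder's inequality brings in the `𝒜_{p'}` mean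
of the dual weight. -/
theorem laverage_opNorm_le_of_one_lt (hp : 1 < p) (hW : IsMatrixWeight W)
    (hQ0 : volume Q ≠ 0) (hQtop : volume Q ≠ ∞) (hRtop : volume R ≠ ∞) :
    ⨍⁻ y in R, opNorm (W y) ∂volume
      ≤ apMean (dualWeight W p) p.conjExponent Q R ^ (p / p.conjExponent)
        * ⨍⁻ y in Q, opNorm (W y) ∂volume := by
  have hpq : p.HolderConjugate p.conjExponent := Real.HolderConjugate.conjExponent hp
  have : IsFiniteMeasure (volume.restrict Q) := ⟨by simpa using hQtop.lt_top⟩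
  have : IsFiniteMeasure (volume.restrict R) := ⟨by simpa using hRtop.lt_top⟩
  have : NeZero (volume.restrict Q) := ⟨by simpa using hQ0⟩
  have hμ := smul_restrict_absolutelyContinuous ((volume.restrict Q) univ)⁻¹ Q
  have hν := smul_restrict_absolutelyContinuous ((volume.restrict R) univ)⁻¹ R
  have hp1 : p - 1 ≠ 0 := by linarith
  have hp0 : p ≠ 0 := hpq.ne_zero
  have hc : p.conjExponent = p / (p - 1) := rfl
  -- the powers of the dual weight in `apMean` are again powers of `W`
  have hd1 (x) : matPow (dualWeight W p x) (1 / p.conjExponent) = matPow (W x) (-1 / p) := by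
    rw [dualWeight, matPow_matPow (hW.posSemidef x)]
    congr 1
    rw [hc]
    field_simp
  have hd2 (x) : matPow (dualWeight W p x) (-1 / p.conjExponent) = matPow (W x) (1 / p) := by
    rw [dualWeight, matPow_matPow (hW.posSemidef x)]
    congr 1
    rw [hc]
    field_simp
  have hcc : p.conjExponent.conjExponent = p := hpq.symm.conjExponent_eq
  rw [apMean_eq_of_one_lt hpq.symm.lt]
  simp only [hd1, hd2, hcc]
  set μ := ((volume.restrict Q) univ)⁻¹ • volume.restrict Q with hμdef
  set ν := ((volume.restrict R) univ)⁻¹ • volume.restrict R with hνdef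
  have hprob : IsProbabilityMeasure μ := by rw [hμdef]; infer_instance
  change ∫⁻ y, opNorm (W y) ∂ν ≤ (∫⁻ x, (∫⁻ y, opNorm (matPow (W x) (-1 / p)
    * matPow (W y) (1 / p)) ^ p ∂ν) ^ (p.conjExponent / p) ∂μ) ^ (p / p.conjExponent)
    * ∫⁻ y, opNorm (W y) ∂μ
  set K : (Fin n → ℝ) → ℝ≥0∞ := fun x => ∫⁻ y, opNorm (matPow (W x) (-1 / p)
    * matPow (W y) (1 / p)) ^ p ∂ν with hK
  set M := ∫⁻ y, opNorm (W y) ∂ν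
  have hKmeas : AEMeasurable K μ :=
    ((hW.aemeasurable_opNorm_mul _ _ hμ hν).pow_const p).lintegral_prod_right'
  have hw : AEMeasurable (fun y => opNorm (W y)) μ := hW.aemeasurable_opNorm.mono_ac hμ
  have hroot (x) : opNorm (W x) = opNorm (matPow (W x) (1 / p)) ^ p := by
    rw [opNorm_matPow (hW.posSemidef x) (by have := hpq.pos; positivity), ← ENNReal.rpow_mul,
      one_div_mul_cancel hp0, ENNReal.rpow_one]
  have hpt : ∀ᵐ x ∂μ, M ≤ K x * opNorm (W x) := by
    filter_upwards [hμ (hW.matPow_neg_mul_matPow (1 / p))] with x hx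
    rw [hK, ← lintegral_mul_const' _ _ (opNorm_lt_top _).ne]
    refine lintegral_mono fun y => ?_
    simp only
    rw [hroot x, ← ENNReal.mul_rpow_of_nonneg _ _ hpq.nonneg, hroot y]
    refine ENNReal.rpow_le_rpow ?_ hpq.nonneg
    rw [opNorm_mul_comm (isHermitian_matPow _ _) (isHermitian_matPow _ _)]
    refine le_trans (le_of_eq ?_) (opNorm_mul_le _ _)
    rw [mul_assoc, neg_div, hx, mul_one]
  have hpinv : 0 ≤ 1 / p := by have := hpq.pos; positivity
  have hM : M ^ (1 / p) ≤ (∫⁻ x, K x ^ (p.conjExponent / p) ∂μ) ^ (1 / p.conjExponent)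
      * (∫⁻ x, opNorm (W x) ∂μ) ^ (1 / p) := by
    calc M ^ (1 / p) = ∫⁻ _, M ^ (1 / p) ∂μ := by simp
      _ ≤ ∫⁻ x, ((fun x => K x ^ (1 / p)) * fun x => opNorm (W x) ^ (1 / p)) x ∂μ := by
          refine lintegral_mono_ae ?_
          filter_upwards [hpt] with x hx
          rw [Pi.mul_apply, ← ENNReal.mul_rpow_of_nonneg _ _ hpinv]
          exact ENNReal.rpow_le_rpow hx hpinv
      _ ≤ _ := ENNReal.lintegral_mul_le_Lp_mul_Lq μ hpq.symm (hKmeas.pow_const _)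
          (hw.pow_const _)
      _ = _ := by
          simp only [← ENNReal.rpow_mul, one_div_mul_cancel hp0, ENNReal.rpow_one]
          congr 4
          ext x
          congr 1
          ring
  have hM' := ENNReal.rpow_le_rpow hM hpq.nonneg
  rw [ENNReal.mul_rpow_of_nonneg _ _ hpq.nonneg, ← ENNReal.rpow_mul, ← ENNReal.rpow_mul,
    ← ENNReal.rpow_mul, one_div_mul_cancel hp0, ENNReal.rpow_one, ENNReal.rpow_one] at hM'
  refine hM'.trans (le_of_eq ?_)
  congr 2
  ring

end Average

/-! ### Dyadic cubes -/

section Cubes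

variable {n d : ℕ}

theorem cube_eq_pi (c : Fin n → ℝ) (l : ℝ) :
    cube c l = Set.pi univ fun i => Ico (c i - l / 2) (c i + l / 2) := by
  ext x
  simp [cube, Set.mem_pi]

theorem measurableSet_cube (c : Fin n → ℝ) (l : ℝ) : MeasurableSet (cube c l) := by
  rw [cube_eq_pi]
  exact MeasurableSet.univ_pi fun _ => measurableSet_Ico

theorem volume_cube (c : Fin n → ℝ) (l : ℝ) : volume (cube c l) = ENNReal.ofReal l ^ n := by
  rw [cube_eq_pi, Real.volume_pi_Ico]
  simp [add_sub_sub_cancel]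

theorem volume_cube_ne_top (c : Fin n → ℝ) (l : ℝ) : volume (cube c l) ≠ ∞ := by
  rw [volume_cube]
  exact ENNReal.pow_ne_top ENNReal.ofReal_ne_top

theorem volume_cube_ne_zero (c : Fin n → ℝ) {l : ℝ} (hl : 0 < l) : volume (cube c l) ≠ 0 := by
  rw [volume_cube]
  exact pow_ne_zero _ (by simpa using hl)

theorem volume_cube_div (c c' : Fin n → ℝ) {l s : ℝ} (hl : 0 < l) (hs : 0 ≤ s) :
    volume (cube c (s * l)) / volume (cube c' l) = ENNReal.ofReal (s ^ n) := by
  have h0 : ENNReal.ofReal l ^ n ≠ 0 := pow_ne_zero _ (by simpa using hl)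
  rw [volume_cube, volume_cube, ENNReal.ofReal_mul hs, mul_pow, ENNReal.ofReal_pow hs,
    ENNReal.mul_div_cancel_right h0 (ENNReal.pow_ne_top ENNReal.ofReal_ne_top)]

/-- The center of `dyadicCube j m`. -/
noncomputable def dyadicCenter (j : ℤ) (m : Fin n → ℤ) : Fin n → ℝ :=
  fun i => (2 : ℝ) ^ (-j) * ((m i : ℝ) + 1 / 2)

theorem dyadicCube_eq_cube (j : ℤ) (m : Fin n → ℤ) :
    dyadicCube j m = cube (dyadicCenter j m) ((2 : ℝ) ^ (-j)) := by
  ext x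
  refine forall_congr' fun i => ?_
  rw [dyadicCenter]
  constructor <;> rintro ⟨h1, h2⟩ <;> constructor <;> linarith

theorem measurableSet_dyadicCube (j : ℤ) (m : Fin n → ℤ) : MeasurableSet (dyadicCube j m) := by
  rw [dyadicCube_eq_cube]
  exact measurableSet_cube _ _

theorem volume_dyadicCube_ne_top (j : ℤ) (m : Fin n → ℤ) : volume (dyadicCube j m) ≠ ∞ := by
  rw [dyadicCube_eq_cube]
  exact volume_cube_ne_top _ _

theorem volume_dyadicCube_ne_zero (j : ℤ) (m : Fin n → ℤ) : volume (dyadicCube j m) ≠ 0 := by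
  rw [dyadicCube_eq_cube]
  exact volume_cube_ne_zero _ (by positivity)

/-- The index `m` of the dyadic cube of edge length `2⁻ʲ` that contains `x`. -/
noncomputable def dyadicIndex (j : ℤ) (x : Fin n → ℝ) : Fin n → ℤ :=
  fun i => ⌊(2 : ℝ) ^ j * x i⌋

theorem measurable_dyadicIndex (j : ℤ) : Measurable (dyadicIndex (n := n) j) :=
  measurable_pi_lambda _ fun i => ((measurable_pi_apply i).const_mul _).floor

theorem mem_dyadicCube_iff {j : ℤ} {m : Fin n → ℤ} {x : Fin n → ℝ} :
    x ∈ dyadicCube j m ↔ dyadicIndex j x = m := by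
  rw [funext_iff]
  refine forall_congr' fun i => ?_
  have h2 : (0 : ℝ) < 2 ^ j := by positivity
  rw [dyadicIndex, Int.floor_eq_iff, zpow_neg, inv_mul_le_iff₀ h2, lt_inv_mul_iff₀ h2]

/-- The index of the ancestor, `k` generations up, of the dyadic cube with index `m`. -/
def dyadicAncestor (k : ℕ) (m : Fin n → ℤ) : Fin n → ℤ := fun i => m i / ((2 ^ k : ℕ) : ℤ)

theorem dyadicIndex_sub (j : ℤ) (k : ℕ) (x : Fin n → ℝ) :
    dyadicIndex (j - k) x = dyadicAncestor k (dyadicIndex j x) := by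
  ext i
  rw [dyadicIndex, dyadicAncestor, dyadicIndex, ← Int.floor_div_natCast, zpow_sub₀ two_ne_zero]
  congr 1
  push_cast
  rw [zpow_natCast]
  ring

theorem dyadicCube_subset_ancestor (j : ℤ) (k : ℕ) (m : Fin n → ℤ) :
    dyadicCube j m ⊆ dyadicCube (j - k) (dyadicAncestor k m) := by
  intro x hx
  rw [mem_dyadicCube_iff] at hx ⊢
  rw [dyadicIndex_sub, hx]

theorem dyadicCenter_mem (j : ℤ) (m : Fin n → ℤ) : dyadicCenter j m ∈ dyadicCube j m := by
  intro i
  have : (0 : ℝ) < 2 ^ (-j) := by positivity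
  rw [dyadicCenter]
  constructor <;> nlinarith

/-- The ancestor `k` generations up is contained in the concentric dilate by `2 ^ (k + 1)`. -/
theorem ancestor_subset_cube (j : ℤ) (k : ℕ) (m : Fin n → ℤ) :
    dyadicCube (j - k) (dyadicAncestor k m)
      ⊆ cube (dyadicCenter j m) (2 ^ (k + 1) * (2 : ℝ) ^ (-j)) := by
  intro y hy i
  have hc := dyadicCube_subset_ancestor j k m (dyadicCenter_mem j m)
  rw [mem_dyadicCube_iff] at hy hc
  have h1 : ⌊(2 : ℝ) ^ (j - k) * y i⌋ = ⌊(2 : ℝ) ^ (j - k) * dyadicCenter j m i⌋ :=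
    (congrFun hy i).trans (congrFun hc i).symm
  have h2 := Int.abs_sub_lt_one_of_floor_eq_floor h1
  have hpos : (0 : ℝ) < 2 ^ (j - k) := by positivity
  rw [← mul_sub, abs_mul, abs_of_pos hpos] at h2
  have h3 : |y i - dyadicCenter j m i| < 2 ^ k * (2 : ℝ) ^ (-j) := by
    rw [← lt_inv_mul_iff₀ hpos, mul_one, ← zpow_neg, neg_sub, sub_eq_add_neg (k : ℤ) j,
      zpow_add₀ two_ne_zero, zpow_natCast] at h2
    exact h2
  rw [abs_lt] at h3
  have h4 : 2 ^ (k + 1) * (2 : ℝ) ^ (-j) / 2 = 2 ^ k * (2 : ℝ) ^ (-j) := by ring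
  rw [h4]
  constructor <;> linarith [h3.1, h3.2]

theorem iUnion_dyadicCube (j : ℤ) : ⋃ m : Fin n → ℤ, dyadicCube j m = univ :=
  eq_univ_of_forall fun x => mem_iUnion.2 ⟨dyadicIndex j x, mem_dyadicCube_iff.2 rfl⟩

theorem pairwise_disjoint_dyadicCube (j : ℤ) :
    Pairwise fun m m' : Fin n → ℤ => Disjoint (dyadicCube j m) (dyadicCube j m') := by
  intro m m' h
  rw [Set.disjoint_left]
  intro x hx hx'
  exact h ((mem_dyadicCube_iff.1 hx).symm.trans (mem_dyadicCube_iff.1 hx'))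

theorem lintegral_eq_tsum_dyadicCube (j : ℤ) (E : Set (Fin n → ℝ)) (hE : MeasurableSet E)
    (F : (Fin n → ℝ) → ℝ≥0∞) :
    ∫⁻ x in E, F x = ∑' m, ∫⁻ x in E ∩ dyadicCube j m, F x := by
  rw [← lintegral_iUnion (fun m => hE.inter (measurableSet_dyadicCube j m))
    (fun m m' h => ((pairwise_disjoint_dyadicCube j h).mono inter_subset_right inter_subset_right)),
    ← inter_iUnion, iUnion_dyadicCube, inter_univ]

theorem dyadicAverage_eq_of_mem (a : ℤ) (f : (Fin n → ℝ) → EuclideanSpace ℂ (Fin d))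
    {m : Fin n → ℤ} {x : Fin n → ℝ} (hx : x ∈ dyadicCube (-a) m) :
    dyadicAverage a f x = ⨍ y in dyadicCube (-a) m, f y := by
  rw [dyadicAverage, tsum_eq_single m, indicator_of_mem hx]
  intro m' hm'
  refine indicator_of_notMem (fun hx' => hm' ?_) _
  exact (mem_dyadicCube_iff.1 hx').symm.trans (mem_dyadicCube_iff.1 hx)

theorem dyadicAverage_eq (a : ℤ) (f : (Fin n → ℝ) → EuclideanSpace ℂ (Fin d)) (x : Fin n → ℝ) :
    dyadicAverage a f x = ⨍ y in dyadicCube (-a) (dyadicIndex (-a) x), f y :=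
  dyadicAverage_eq_of_mem a f (mem_dyadicCube_iff.2 rfl)

/-- The dyadic average of `f` at `x` is a function of the discrete variable `dyadicIndex (-a) x`. -/
theorem aestronglyMeasurable_dyadicAverage (a : ℤ)
    (f : (Fin n → ℝ) → EuclideanSpace ℂ (Fin d)) :
    AEStronglyMeasurable (dyadicAverage a f) volume := by
  have h : dyadicAverage a f
      = (fun m : Fin n → ℤ => ⨍ y in dyadicCube (-a) m, f y) ∘ dyadicIndex (-a) := by
    ext1 x
    exact dyadicAverage_eq a f x
  rw [h]
  exact ((measurable_of_countable _).comp (measurable_dyadicIndex (-a))).aestronglyMeasurable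

theorem exists_isCompact_dyadicCube_subset (j : ℤ) (m : Fin n → ℤ) :
    ∃ K, IsCompact K ∧ dyadicCube j m ⊆ K :=
  ⟨Icc (fun i => (2 : ℝ) ^ (-j) * (m i : ℝ)) (fun i => (2 : ℝ) ^ (-j) * ((m i : ℝ) + 1)),
    isCompact_Icc, fun _ hx => ⟨fun i => (hx i).1, fun i => (hx i).2.le⟩⟩

theorem finite_dyadicCube_inter (j : ℤ) {K : Set (Fin n → ℝ)} (hK : IsCompact K) :
    {m : Fin n → ℤ | (K ∩ dyadicCube j m).Nonempty}.Finite := by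
  obtain ⟨c, hc⟩ := hK.isBounded.bddBelow
  obtain ⟨b, hb⟩ := hK.isBounded.bddAbove
  refine (Set.finite_Icc (dyadicIndex j c) (dyadicIndex j b)).subset ?_
  rintro m ⟨x, hxK, hx⟩
  rw [mem_dyadicCube_iff] at hx
  rw [← hx]
  have h2 : (0 : ℝ) ≤ 2 ^ j := by positivity
  exact ⟨fun i => Int.floor_le_floor (mul_le_mul_of_nonneg_left (hc hxK i) h2),
    fun i => Int.floor_le_floor (mul_le_mul_of_nonneg_left (hb hxK i) h2)⟩

/-- Each dyadic cube has `2 ^ (k n)` descendants `k` generations down. -/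
theorem tsum_dyadicAncestor (k : ℕ) (F : (Fin n → ℤ) → ℝ≥0∞) :
    ∑' m, F (dyadicAncestor k m) = (2 : ℝ≥0∞) ^ (k * n) * ∑' m, F m := by
  have : NeZero (2 ^ k) := ⟨by positivity⟩
  let e : (Fin n → ℤ) ≃ (Fin n → ℤ) × (Fin n → Fin (2 ^ k)) :=
    (Equiv.piCongrRight fun _ => Int.divModEquiv (2 ^ k)).trans
      (Equiv.arrowProdEquivProdArrow _ _ _)
  have he (m) : dyadicAncestor k m = (e m).1 := rfl
  simp only [he]
  rw [e.tsum_eq (fun z : (Fin n → ℤ) × (Fin n → Fin (2 ^ k)) => F z.1), ENNReal.tsum_prod']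
  simp only [tsum_fintype, Finset.sum_const, Finset.card_univ, Fintype.card_pi, Fintype.card_fin,
    Finset.prod_const, nsmul_eq_mul]
  rw [ENNReal.tsum_mul_left]
  congr 1
  push_cast
  rw [pow_mul]

end Cubes

/-! ### The sequence space estimate -/

section Sequence

variable {n : ℕ}

theorem ofReal_two_rpow (x : ℝ) : ENNReal.ofReal ((2 : ℝ) ^ x) = (2 : ℝ≥0∞) ^ x := by
  rw [← ENNReal.ofReal_rpow_of_pos two_pos]
  simp

/-- If a family indexed by the dyadic cubes is dominated by `u` on large cubes and, on the cubes
`k` generations below level `j₀`, by `2 ^ (k γ)` times the value of `u` at the ancestor of level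
`j₀`, then its `ℓ^r` norm is dominated by that of `u`: each generation contributes
`2 ^ (k (γ r + n))` times the `ℓ^r` sum over level `j₀`. -/
theorem exists_lrNorm_le {r : ℝ} (hr : 0 < r) {γ : ℝ} (hγ : γ * r + n < 0) {K : ℝ≥0∞}
    (hK : K ≠ ∞) (j₀ : ℤ) :
    ∃ C : ℝ≥0, ∀ u v : ℤ × (Fin n → ℤ) → ℝ≥0∞,
      (∀ j m, j ≤ j₀ → v (j, m) ≤ K * u (j, m)) →
      (∀ (k : ℕ) m, v (j₀ + k, m) ≤ K * 2 ^ (k * γ) * u (j₀, dyadicAncestor k m)) →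
      lrNorm (ENNReal.ofReal r) v ≤ C * lrNorm (ENNReal.ofReal r) u := by
  set θ : ℝ≥0∞ := 2 ^ (γ * r + n) with hθ
  have hθ1 : θ < 1 := ENNReal.rpow_lt_one_of_one_lt_of_neg (by norm_num) hγ
  set C₀ : ℝ≥0∞ := K ^ r * (1 + (1 - θ)⁻¹) with hC₀
  have hC₀top : C₀ ≠ ∞ := by
    refine ENNReal.mul_ne_top (ENNReal.rpow_ne_top_of_nonneg hr.le hK) ?_
    refine ENNReal.add_ne_top.2 ⟨ENNReal.one_ne_top, ENNReal.inv_ne_top.2 ?_⟩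
    exact (tsub_pos_of_lt hθ1).ne'
  have hCtop : C₀ ^ (1 / r) ≠ ∞ := ENNReal.rpow_ne_top_of_nonneg (by positivity) hC₀top
  refine ⟨(C₀ ^ (1 / r)).toNNReal, fun u v hlarge hsmall => ?_⟩
  rw [ENNReal.coe_toNNReal hCtop, lrNorm, lrNorm, if_neg ENNReal.ofReal_ne_top,
    if_neg ENNReal.ofReal_ne_top, ENNReal.toReal_ofReal hr.le,
    ← ENNReal.mul_rpow_of_nonneg _ _ (by positivity : 0 ≤ 1 / r)]
  refine ENNReal.rpow_le_rpow ?_ (by positivity)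
  rw [ENNReal.tsum_prod', ENNReal.tsum_prod']
  set S : ℤ → ℝ≥0∞ := fun j => ∑' m, u (j, m) ^ r with hS
  have h1 (j : ℤ) (hj : j ≤ j₀) : ∑' m, v (j, m) ^ r ≤ K ^ r * S j := by
    rw [hS, ← ENNReal.tsum_mul_left]
    refine ENNReal.tsum_le_tsum fun m => ?_
    rw [← ENNReal.mul_rpow_of_nonneg _ _ hr.le]
    exact ENNReal.rpow_le_rpow (hlarge j m hj) hr.le
  have h2 (k : ℕ) : ∑' m, v (j₀ + k, m) ^ r ≤ K ^ r * θ ^ k * S j₀ := by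
    have hθk : K ^ r * θ ^ k * S j₀
        = (K * 2 ^ (k * γ)) ^ r * ((2 : ℝ≥0∞) ^ (k * n) * S j₀) := by
      rw [ENNReal.mul_rpow_of_nonneg _ _ hr.le, ← ENNReal.rpow_mul, hθ, ← ENNReal.rpow_natCast,
        ← ENNReal.rpow_natCast, ← ENNReal.rpow_mul, mul_assoc, mul_assoc,
        ← mul_assoc ((2 : ℝ≥0∞) ^ (k * γ * r)),
        ← ENNReal.rpow_add _ _ two_ne_zero ENNReal.ofNat_ne_top]
      congr 3
      push_cast
      ring_nf
    rw [hθk, hS, ← tsum_dyadicAncestor k fun m => u (j₀, m) ^ r, ← ENNReal.tsum_mul_left]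
    refine ENNReal.tsum_le_tsum fun m => ?_
    rw [← ENNReal.mul_rpow_of_nonneg _ _ hr.le]
    exact ENNReal.rpow_le_rpow (hsmall k m) hr.le
  -- the sum over `k` has at most one nonzero term, the one with `k = j - j₀`
  have h3 (j : ℤ) : ∑' m, v (j, m) ^ r
      ≤ K ^ r * S j + ∑' k : ℕ, if j = j₀ + k then K ^ r * θ ^ k * S j₀ else 0 := by
    rcases le_total j j₀ with hj | hj
    · exact (h1 j hj).trans le_self_add
    · obtain ⟨k, rfl⟩ := Int.le.dest hj
      refine (h2 k).trans (le_trans ?_ le_add_self)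
      refine le_trans ?_ (ENNReal.le_tsum k)
      simp
  have h4 : ∑' j : ℤ, ∑' k : ℕ, (if j = j₀ + k then K ^ r * θ ^ k * S j₀ else 0)
      = K ^ r * (1 - θ)⁻¹ * S j₀ := by
    rw [ENNReal.tsum_comm]
    simp only [tsum_ite_eq]
    rw [ENNReal.tsum_mul_right, ENNReal.tsum_mul_left, ENNReal.tsum_geometric]
  calc ∑' j, ∑' m, v (j, m) ^ r
      ≤ ∑' j, (K ^ r * S j + ∑' k : ℕ, if j = j₀ + k then K ^ r * θ ^ k * S j₀ else 0) :=
        ENNReal.tsum_le_tsum h3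
    _ = K ^ r * ∑' j, S j + K ^ r * (1 - θ)⁻¹ * S j₀ := by
        rw [ENNReal.tsum_add, h4, ENNReal.tsum_mul_left]
    _ ≤ K ^ r * ∑' j, S j + K ^ r * (1 - θ)⁻¹ * ∑' j, S j := by
        gcongr
        exact ENNReal.le_tsum j₀
    _ = C₀ * ∑' j, S j := by
        rw [hC₀]
        ring

theorem exists_lrNorm_top_le {γ : ℝ} (hγ : γ ≤ 0) {K : ℝ≥0∞} (hK : K ≠ ∞) (j₀ : ℤ) :
    ∃ C : ℝ≥0, ∀ u v : ℤ × (Fin n → ℤ) → ℝ≥0∞,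
      (∀ j m, j ≤ j₀ → v (j, m) ≤ K * u (j, m)) →
      (∀ (k : ℕ) m, v (j₀ + k, m) ≤ K * 2 ^ (k * γ) * u (j₀, dyadicAncestor k m)) →
      lrNorm ∞ v ≤ C * lrNorm ∞ u := by
  refine ⟨K.toNNReal, fun u v hlarge hsmall => ?_⟩
  rw [ENNReal.coe_toNNReal hK, lrNorm, lrNorm, if_pos rfl, if_pos rfl]
  refine iSup_le fun ⟨j, m⟩ => ?_
  rcases le_total j j₀ with hj | hj
  · exact (hlarge j m hj).trans (mul_le_mul_right (le_iSup u _) _)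
  · obtain ⟨k, rfl⟩ := Int.le.dest hj
    refine (hsmall k m).trans (mul_le_mul' ?_ (le_iSup u _))
    refine mul_le_of_le_one_right' ?_
    rw [← ENNReal.rpow_zero (x := 2)]
    exact ENNReal.rpow_le_rpow_of_exponent_le one_le_two
      (mul_nonpos_of_nonneg_of_nonpos k.cast_nonneg hγ)

end Sequence

/-! ### Dyadic cubes and their ancestors: the two exponents -/

section Ancestor

variable {n d : ℕ} {W : (Fin n → ℝ) → Matrix (Fin d) (Fin d) ℂ} {p : ℝ}
  {P Q R : Set (Fin n → ℝ)}

theorem setLAverage_le_of_subset (hPR : P ⊆ R) (hRtop : volume R ≠ ∞) (F : (Fin n → ℝ) → ℝ≥0∞) :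
    ⨍⁻ x in P, F x ∂volume ≤ volume R / volume P * ⨍⁻ x in R, F x ∂volume := by
  calc ⨍⁻ x in P, F x ∂volume = (∫⁻ x in P, F x) / volume P := setLAverage_eq _ _ _
    _ ≤ (∫⁻ x in R, F x) / volume P := by gcongr
    _ = volume R / volume P * ⨍⁻ x in R, F x ∂volume := by
        rw [← measure_mul_setLAverage F hRtop]
        simp only [div_eq_mul_inv]
        ring

theorem apMean_le_of_subset (hp : 1 ≤ p) (hPR : P ⊆ R) (hP0 : volume P ≠ 0)
    (hRtop : volume R ≠ ∞) :
    apMean W p Q P ≤ (volume R / volume P) ^ (p - 1) * apMean W p Q R := by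
  rcases hp.eq_or_lt with rfl | hp
  · rw [apMean_one, apMean_one, sub_self, ENNReal.rpow_zero, one_mul]
    exact essSup_mono_measure
      (Measure.absolutelyContinuous_of_le (Measure.restrict_mono_set _ hPR))
  · have hpq : p.HolderConjugate p.conjExponent := Real.HolderConjugate.conjExponent hp
    have he : p / p.conjExponent = p - 1 := hpq.div_conj_eq_sub_one
    have hp1 : 0 ≤ p - 1 := by linarith
    rw [apMean_eq_of_one_lt hp, apMean_eq_of_one_lt hp, he, laverage, laverage,
      ← lintegral_const_mul' _ _
        (ENNReal.rpow_ne_top_of_nonneg hp1 (ENNReal.div_ne_top hRtop hP0))]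
    refine lintegral_mono fun x => ?_
    simp only
    rw [← ENNReal.mul_rpow_of_nonneg _ _ hp1]
    exact ENNReal.rpow_le_rpow (setLAverage_le_of_subset hPR hRtop _) hp1

theorem two_zpow_neg_sub (j : ℤ) (k : ℕ) : (2 : ℝ) ^ (-(j - k)) = 2 ^ k * 2 ^ (-j) := by
  rw [neg_sub, sub_eq_add_neg (k : ℤ) j, zpow_add₀ two_ne_zero, zpow_natCast]

theorem volume_dyadicCube_div_ancestor (j : ℤ) (k : ℕ) (m : Fin n → ℤ) :
    volume (dyadicCube j m) / volume (dyadicCube (j - k) (dyadicAncestor k m))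
      = 2 ^ (-((k : ℝ) * n)) := by
  have h : (2 : ℝ) ^ (-j) = (2 ^ k)⁻¹ * (2 : ℝ) ^ (-(j - k)) := by
    rw [two_zpow_neg_sub, inv_mul_cancel_left₀ (by positivity)]
  rw [dyadicCube_eq_cube, dyadicCube_eq_cube, h, volume_cube_div _ _ (by positivity)
    (by positivity), ← ofReal_two_rpow, Real.rpow_neg zero_le_two, inv_pow, ← pow_mul]
  norm_cast

theorem volume_dilate_div_dyadicCube (j : ℤ) (k : ℕ) (m : Fin n → ℤ) :
    volume (cube (dyadicCenter j m) (2 ^ (k + 1) * (2 : ℝ) ^ (-j))) / volume (dyadicCube j m)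
      = 2 ^ (((k : ℝ) + 1) * n) := by
  rw [dyadicCube_eq_cube, volume_cube_div _ _ (by positivity) (by positivity),
    ← ofReal_two_rpow, ← pow_mul]
  norm_cast

theorem volume_dilate_div_ancestor (j : ℤ) (k : ℕ) (m : Fin n → ℤ) :
    volume (cube (dyadicCenter j m) (2 ^ (k + 1) * (2 : ℝ) ^ (-j)))
      / volume (dyadicCube (j - k) (dyadicAncestor k m)) = 2 ^ n := by
  rw [dyadicCube_eq_cube (j - k), two_zpow_neg_sub, pow_succ', mul_assoc,
    volume_cube_div _ _ (by positivity) (by positivity), ENNReal.ofReal_pow zero_le_two]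
  simp

/-- The ancestor of `Q` lies in the dilate of `Q` by `2 ^ (k + 1)`, which has `2 ^ n` times its
volume, so the `𝒜_p`-dimension controls `apMean` between `Q` and its ancestor. -/
theorem exists_apMean_ancestor_le (hp : 1 ≤ p) {D : ℝ} (hD : HasApDimension W p D) :
    ∃ K : ℝ≥0∞, K ≠ ∞ ∧ ∀ (j : ℤ) (k : ℕ) (m : Fin n → ℤ),
      apMean W p (dyadicCube j m) (dyadicCube (j - k) (dyadicAncestor k m)) ≤ K * 2 ^ (k * D) := by
  obtain ⟨-, C, hC⟩ := hD
  refine ⟨((2 : ℝ≥0∞) ^ n) ^ (p - 1) * (C * 2 ^ D), ?_, fun j k m => ?_⟩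
  · refine ENNReal.mul_ne_top (ENNReal.rpow_ne_top_of_nonneg (by linarith)
      (ENNReal.pow_ne_top ENNReal.ofNat_ne_top)) (ENNReal.mul_ne_top ENNReal.coe_ne_top ?_)
    exact ENNReal.rpow_ne_top_of_ne_zero two_ne_zero ENNReal.ofNat_ne_top
  · have h1 := apMean_le_of_subset (W := W) (Q := dyadicCube j m) hp (ancestor_subset_cube j k m)
      (volume_dyadicCube_ne_zero _ _) (volume_cube_ne_top _ _)
    have h2 := hC (dyadicCenter j m) ((2 : ℝ) ^ (-j)) (by positivity) (k + 1)
    rw [← dyadicCube_eq_cube, ofReal_two_rpow] at h2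
    rw [volume_dilate_div_ancestor] at h1
    refine h1.trans ((mul_le_mul_right h2 _).trans (le_of_eq ?_))
    have h3 : (2 : ℝ≥0∞) ^ (((k + 1 : ℕ) : ℝ) * D) = 2 ^ (k * D) * 2 ^ D := by
      rw [← ENNReal.rpow_add _ _ two_ne_zero ENNReal.ofNat_ne_top]
      congr 1
      push_cast
      ring
    rw [h3]
    ring

theorem weightMass_eq_mul_laverage (hQtop : volume Q ≠ ∞) :
    weightMass W Q = volume Q * ⨍⁻ y in Q, opNorm (W y) ∂volume :=
  (measure_mul_setLAverage _ hQtop).symm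

theorem weightMass_mono (hPR : P ⊆ R) : weightMass W P ≤ weightMass W R :=
  lintegral_mono_set hPR

theorem weightMass_le_of_laverage_le (hQ0 : volume Q ≠ 0) (hQtop : volume Q ≠ ∞)
    (hRtop : volume R ≠ ∞) {X : ℝ≥0∞}
    (h : ⨍⁻ y in R, opNorm (W y) ∂volume ≤ X * ⨍⁻ y in Q, opNorm (W y) ∂volume) :
    weightMass W R ≤ volume R / volume Q * X * weightMass W Q := by
  rw [weightMass_eq_mul_laverage hQtop, weightMass_eq_mul_laverage hRtop]
  refine (mul_le_mul_right h _).trans (le_of_eq ?_)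
  have h1 : volume R = volume R / volume Q * volume Q := (ENNReal.div_mul_cancel hQ0 hQtop).symm
  conv_lhs => rw [h1]
  ring

/-- The mass `W(Q)` is doubling with exponent `betaTilde`. The constant is kept nonzero (hence
`C + 1` in place of `C` below) because the estimate is used with a negative power. -/
theorem exists_weightMass_ancestor_le (hp : 1 ≤ p) (hW : IsMatrixAp W p) {D' : ℝ}
    (hD' : 1 < p → HasApDimension (dualWeight W p) (Real.conjExponent p) D') :
    ∃ K : ℝ≥0∞, K ≠ ∞ ∧ K ≠ 0 ∧ ∀ (j : ℤ) (k : ℕ) (m : Fin n → ℤ),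
      weightMass W (dyadicCube (j - k) (dyadicAncestor k m))
        ≤ K * 2 ^ (k * betaTilde n p D') * weightMass W (dyadicCube j m) := by
  have hmono (j : ℤ) (k : ℕ) (m : Fin n → ℤ) :=
    weightMass_mono (W := W) (ancestor_subset_cube j k m)
  have hsub (j : ℤ) (k : ℕ) (m : Fin n → ℤ) :=
    (dyadicCube_subset_ancestor j k m).trans (ancestor_subset_cube j k m)
  have h2 (x : ℝ) : (2 : ℝ≥0∞) ^ x ≠ 0 ∧ (2 : ℝ≥0∞) ^ x ≠ ∞ :=
    ⟨(ENNReal.rpow_pos two_pos ENNReal.ofNat_ne_top).ne',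
      ENNReal.rpow_ne_top_of_ne_zero two_ne_zero ENNReal.ofNat_ne_top⟩
  rcases hp.eq_or_lt with rfl | hp
  · obtain ⟨hW, C, hC⟩ := hW
    refine ⟨2 ^ (n : ℝ) * ((C + 1 : ℝ≥0) : ℝ≥0∞), ENNReal.mul_ne_top (h2 _).2 ENNReal.coe_ne_top,
      mul_ne_zero (h2 _).1 (by simp), fun j k m => (hmono j k m).trans ?_⟩
    have h := weightMass_le_of_laverage_le (volume_dyadicCube_ne_zero j m)
      (volume_dyadicCube_ne_top j m) (volume_cube_ne_top _ _)
      (laverage_opNorm_le_of_one hW (hsub j k m) (volume_dyadicCube_ne_zero j m)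
        (volume_dyadicCube_ne_top j m))
    refine h.trans (mul_le_mul_left ?_ _)
    have hC' : apMean W 1 (cube (dyadicCenter j m) (2 ^ (k + 1) * (2 : ℝ) ^ (-j)))
        (cube (dyadicCenter j m) (2 ^ (k + 1) * (2 : ℝ) ^ (-j))) ≤ ((C + 1 : ℝ≥0) : ℝ≥0∞) :=
      (hC _ _ (by positivity)).trans (by simp)
    refine (mul_le_mul_right hC' _).trans (le_of_eq ?_)
    rw [volume_dilate_div_dyadicCube, betaTilde, if_pos rfl, add_mul, one_mul,
      ENNReal.rpow_add _ _ two_ne_zero ENNReal.ofNat_ne_top]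
    ring
  · have hpq : p.HolderConjugate p.conjExponent := Real.HolderConjugate.conjExponent hp
    obtain ⟨-, C, hC⟩ := hD' hp
    set s : ℝ := p / p.conjExponent with hs
    have hs0 : 0 ≤ s := div_nonneg hpq.nonneg hpq.symm.nonneg
    refine ⟨2 ^ (n : ℝ) * (((C + 1 : ℝ≥0) : ℝ≥0∞) ^ s * 2 ^ (D' * s)), ?_, ?_,
      fun j k m => (hmono j k m).trans ?_⟩
    · exact ENNReal.mul_ne_top (h2 _).2 (ENNReal.mul_ne_top
        (ENNReal.rpow_ne_top_of_nonneg hs0 ENNReal.coe_ne_top) (h2 _).2)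
    · exact mul_ne_zero (h2 _).1 (mul_ne_zero
        (ENNReal.rpow_pos (by simp) ENNReal.coe_ne_top).ne' (h2 _).1)
    · have h := weightMass_le_of_laverage_le (volume_dyadicCube_ne_zero j m)
        (volume_dyadicCube_ne_top j m) (volume_cube_ne_top _ _)
        (laverage_opNorm_le_of_one_lt (R := cube (dyadicCenter j m) (2 ^ (k + 1) * (2 : ℝ) ^ (-j)))
          hp hW.1 (volume_dyadicCube_ne_zero j m)
          (volume_dyadicCube_ne_top j m) (volume_cube_ne_top _ _))
      refine h.trans (mul_le_mul_left ?_ _)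
      have hC' : apMean (dualWeight W p) p.conjExponent (dyadicCube j m)
          (cube (dyadicCenter j m) (2 ^ (k + 1) * (2 : ℝ) ^ (-j)))
          ≤ ((C + 1 : ℝ≥0) : ℝ≥0∞) * 2 ^ (((k : ℝ) + 1) * D') := by
        have h3 := hC (dyadicCenter j m) ((2 : ℝ) ^ (-j)) (by positivity) (k + 1)
        rw [← dyadicCube_eq_cube, ofReal_two_rpow] at h3
        push_cast at h3 ⊢
        exact h3.trans (mul_le_mul_left le_self_add _)
      refine (mul_le_mul_right (ENNReal.rpow_le_rpow hC' hs0) _).trans (le_of_eq ?_)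
      have hβ : betaTilde n p D' = n + D' * s := by
        rw [betaTilde, if_neg hp.ne', hs, mul_div_assoc]
      have e1 : ((k : ℝ) + 1) * n = n + k * n := by ring
      have e2 : ((k : ℝ) + 1) * D' * s = D' * s + k * (D' * s) := by ring
      rw [volume_dilate_div_dyadicCube, hβ, ENNReal.mul_rpow_of_nonneg _ _ hs0,
        ← ENNReal.rpow_mul, e1, e2, mul_add]
      simp only [ENNReal.rpow_add _ _ two_ne_zero ENNReal.ofNat_ne_top]
      ring

theorem rpow_mul_le_of_le_mul {a b K : ℝ≥0∞} (hK0 : K ≠ 0) (hK : K ≠ ∞) {σ : ℝ} (hσ : 0 ≤ σ)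
    (h : b ≤ K * a) : a ^ (-σ) ≤ K ^ σ * b ^ (-σ) := by
  have h1 : K ^ σ ≠ 0 := (ENNReal.rpow_pos (pos_iff_ne_zero.2 hK0) hK).ne'
  have h2 : K ^ σ ≠ ∞ := ENNReal.rpow_ne_top_of_nonneg hσ hK
  have h3 : b ^ σ ≤ K ^ σ * a ^ σ := by
    rw [← ENNReal.mul_rpow_of_nonneg _ _ hσ]
    exact ENNReal.rpow_le_rpow h hσ
  rw [ENNReal.rpow_neg, ENNReal.rpow_neg]
  calc (a ^ σ)⁻¹ = K ^ σ * (K ^ σ * a ^ σ)⁻¹ := by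
        rw [ENNReal.mul_inv (Or.inl h1) (Or.inl h2), ← mul_assoc, ENNReal.mul_inv_cancel h1 h2,
          one_mul]
    _ ≤ _ := mul_le_mul_right (ENNReal.inv_le_inv.2 h3) _

end Ancestor

/-! ### The dyadic averages on the weighted spaces -/

section Operator

variable {n d : ℕ} {W : (Fin n → ℝ) → Matrix (Fin d) (Fin d) ℂ} {p : ℝ}

theorem weightedIntegral_dyadicCube_ne_top {f : (Fin n → ℝ) → EuclideanSpace ℂ (Fin d)}
    (hf : f ∈ LpLoc W p) (j : ℤ) (m : Fin n → ℤ) :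
    weightedIntegral W p f (dyadicCube j m) ≠ ∞ := by
  obtain ⟨K, hK, hsub⟩ := exists_isCompact_dyadicCube_subset j m
  exact ((lintegral_mono_set hsub).trans_lt (hf.2 K hK)).ne

theorem weightedIntegral_congr_on {E : Set (Fin n → ℝ)} (hE : MeasurableSet E)
    {f g : (Fin n → ℝ) → EuclideanSpace ℂ (Fin d)} (h : ∀ x ∈ E, f x = g x) :
    weightedIntegral W p f E = weightedIntegral W p g E := by
  refine setLIntegral_congr_fun hE fun x hx => ?_
  simp only [h x hx]

theorem apMean_dyadicCube_self_ne_top (hW : IsMatrixAp W p) (j : ℤ) (m : Fin n → ℤ) :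
    apMean W p (dyadicCube j m) (dyadicCube j m) ≠ ∞ := by
  obtain ⟨-, C, hC⟩ := hW
  rw [dyadicCube_eq_cube]
  exact ((hC _ _ (by positivity)).trans_lt ENNReal.coe_lt_top).ne

theorem integrableOn_dyadicCube (hp : 1 ≤ p) (hW : IsMatrixAp W p)
    {f : (Fin n → ℝ) → EuclideanSpace ℂ (Fin d)} (hf : f ∈ LpLoc W p) (j : ℤ) (m : Fin n → ℤ) :
    IntegrableOn f (dyadicCube j m) :=
  integrableOn_of_apMean_ne_top hp hW.1 (volume_dyadicCube_ne_zero j m)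
    (volume_dyadicCube_ne_top j m) (apMean_dyadicCube_self_ne_top hW j m) hf.1
    (weightedIntegral_dyadicCube_ne_top hf j m)

/-- The local estimate on a cube `Q` at most as large as the cubes of the average. -/
theorem exists_weightedIntegral_dyadicAverage_le (hp : 1 ≤ p) (hW : IsMatrixAp W p) {D : ℝ}
    (hD : HasApDimension W p D) (a : ℤ) :
    ∃ K : ℝ≥0∞, K ≠ ∞ ∧ ∀ f ∈ LpLoc W p, ∀ (k : ℕ) (m : Fin n → ℤ),
      weightedIntegral W p (dyadicAverage a f) (dyadicCube (-a + k) m)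
        ≤ K * 2 ^ (k * (D - n))
          * weightedIntegral W p f (dyadicCube (-a) (dyadicAncestor k m)) := by
  obtain ⟨K, hK, h⟩ := exists_apMean_ancestor_le hp hD
  refine ⟨K, hK, fun f hf k m => ?_⟩
  have h1 := h (-a + k) k m
  have h2 := volume_dyadicCube_div_ancestor (-a + k) k m
  have h3 := dyadicCube_subset_ancestor (-a + k) k m
  rw [add_sub_cancel_right] at h1 h2 h3
  rw [weightedIntegral_congr_on (measurableSet_dyadicCube _ _) fun x hx =>
    dyadicAverage_eq_of_mem a f (h3 hx)]
  refine (weightedIntegral_average_le hp hW.1 (volume_dyadicCube_ne_top _ _)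
    (volume_dyadicCube_ne_top _ _) hf.1 (integrableOn_dyadicCube hp hW hf _ _)
    (weightedIntegral_dyadicCube_ne_top hf _ _)).trans (mul_le_mul_left ?_ _)
  rw [h2]
  refine (mul_le_mul_right h1 _).trans (le_of_eq ?_)
  have e : (k : ℝ) * (D - n) = -(k * n) + k * D := by ring
  rw [e, ENNReal.rpow_add _ _ two_ne_zero ENNReal.ofNat_ne_top]
  ring

theorem dyadicCube_inter_of_le {j j' : ℤ} (hj : j ≤ j') (m m' : Fin n → ℤ) :
    dyadicCube j m ∩ dyadicCube j' m' = dyadicCube j' m' ∨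
      dyadicCube j m ∩ dyadicCube j' m' = ∅ := by
  obtain ⟨k, rfl⟩ := Int.le.dest hj
  by_cases h : dyadicAncestor k m' = m
  · left
    have := dyadicCube_subset_ancestor (j + k) k m'
    rw [add_sub_cancel_right, h] at this
    exact inter_eq_right.2 this
  · right
    refine eq_empty_of_forall_notMem fun x hx => h ?_
    have h1 := mem_dyadicCube_iff.1 hx.1
    have h2 := dyadicIndex_sub (j + k) k x
    rw [add_sub_cancel_right, h1, mem_dyadicCube_iff.1 hx.2] at h2
    exact h2.symm

/-- Both estimates of the averages: a cube larger than the cubes of the average splits into such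
cubes, on each of which the local estimate applies. -/
theorem exists_weightedIntegral_dyadicAverage_le_large_and_small (hp : 1 ≤ p)
    (hW : IsMatrixAp W p) {D : ℝ} (hD : HasApDimension W p D) (a : ℤ) :
    ∃ K : ℝ≥0∞, K ≠ ∞ ∧ ∀ f ∈ LpLoc W p,
      (∀ (j : ℤ) (m : Fin n → ℤ), j ≤ -a →
        weightedIntegral W p (dyadicAverage a f) (dyadicCube j m)
          ≤ K * weightedIntegral W p f (dyadicCube j m)) ∧
      ∀ (k : ℕ) (m : Fin n → ℤ),
        weightedIntegral W p (dyadicAverage a f) (dyadicCube (-a + k) m)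
          ≤ K * 2 ^ (k * (D - n))
            * weightedIntegral W p f (dyadicCube (-a) (dyadicAncestor k m)) := by
  obtain ⟨K, hK, h⟩ := exists_weightedIntegral_dyadicAverage_le hp hW hD a
  refine ⟨K, hK, fun f hf => ⟨fun j m hj => ?_, h f hf⟩⟩
  have h0 (m') : weightedIntegral W p (dyadicAverage a f) (dyadicCube (-a) m')
      ≤ K * weightedIntegral W p f (dyadicCube (-a) m') := by
    have := h f hf 0 m'
    have h00 : dyadicAncestor 0 m' = m' := by
      ext i
      simp [dyadicAncestor]
    simpa [h00] using this
  unfold weightedIntegral at h0 ⊢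
  rw [lintegral_eq_tsum_dyadicCube (-a) _ (measurableSet_dyadicCube j m),
    lintegral_eq_tsum_dyadicCube (-a) _ (measurableSet_dyadicCube j m), ← ENNReal.tsum_mul_left]
  refine ENNReal.tsum_le_tsum fun m' => ?_
  rcases dyadicCube_inter_of_le hj m m' with h1 | h1
  · rw [h1]
    exact h0 m'
  · simp [h1]

theorem dyadicAverage_mem_LpLoc (hp : 1 ≤ p) (hW : IsMatrixAp W p) {D : ℝ}
    (hD : HasApDimension W p D) (a : ℤ) {f : (Fin n → ℝ) → EuclideanSpace ℂ (Fin d)}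
    (hf : f ∈ LpLoc W p) : dyadicAverage a f ∈ LpLoc W p := by
  obtain ⟨C, hC, h⟩ := exists_weightedIntegral_dyadicAverage_le_large_and_small hp hW hD a
  refine ⟨aestronglyMeasurable_dyadicAverage a f, fun K hK => ?_⟩
  unfold weightedIntegral
  rw [lintegral_eq_tsum_dyadicCube (-a) K hK.measurableSet]
  have hfin := finite_dyadicCube_inter (-a) hK
  rw [tsum_eq_sum (s := hfin.toFinset) fun m hm => ?_]
  · refine ENNReal.sum_lt_top.2 fun m _ => ?_
    refine (lintegral_mono_set inter_subset_right).trans_lt ?_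
    refine ((h f hf).1 (-a) m le_rfl).trans_lt ?_
    exact ENNReal.mul_lt_top hC.lt_top (weightedIntegral_dyadicCube_ne_top hf _ _).lt_top
  · have : K ∩ dyadicCube (-a) m = ∅ := by simpa [Set.not_nonempty_iff_eq_empty] using hm
    simp [this]

/-- The terms of the `M_p^{t,r}(W)` norm of the average: on large cubes they are dominated by those
of `f`, and on the cubes `k` generations below the averaging level by a multiple of the term of the
ancestor at that level. -/
theorem exists_bmTerm_dyadicAverage_le (hp : 1 ≤ p) (hW : IsMatrixAp W p) {D D' : ℝ}
    (hD : HasApDimension W p D)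
    (hD' : 1 < p → HasApDimension (dualWeight W p) (Real.conjExponent p) D')
    {t : ℝ} (ht : p ≤ t) (a : ℤ) :
    ∃ K : ℝ≥0∞, K ≠ ∞ ∧ ∀ f ∈ LpLoc W p,
      (∀ (j : ℤ) (m : Fin n → ℤ), j ≤ -a →
        weightMass W (dyadicCube j m) ^ (1 / t - 1 / p)
          * weightedIntegral W p (dyadicAverage a f) (dyadicCube j m) ^ (1 / p)
        ≤ K * (weightMass W (dyadicCube j m) ^ (1 / t - 1 / p)
          * weightedIntegral W p f (dyadicCube j m) ^ (1 / p))) ∧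
      ∀ (k : ℕ) (m : Fin n → ℤ),
        weightMass W (dyadicCube (-a + k) m) ^ (1 / t - 1 / p)
          * weightedIntegral W p (dyadicAverage a f) (dyadicCube (-a + k) m) ^ (1 / p)
        ≤ K * 2 ^ (k * (D / p - n / p - betaTilde n p D' * (1 / t - 1 / p)))
          * (weightMass W (dyadicCube (-a) (dyadicAncestor k m)) ^ (1 / t - 1 / p)
            * weightedIntegral W p f (dyadicCube (-a) (dyadicAncestor k m)) ^ (1 / p)) := by
  obtain ⟨K, hK, h⟩ := exists_weightedIntegral_dyadicAverage_le_large_and_small hp hW hD a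
  obtain ⟨L, hL, hL0, hmass⟩ := exists_weightMass_ancestor_le hp hW hD'
  have hp0 : 0 < p := by linarith
  have hpinv : 0 ≤ 1 / p := by positivity
  have hKp : K ^ (1 / p) ≠ ∞ := ENNReal.rpow_ne_top_of_nonneg hpinv hK
  obtain ⟨σ, hσ⟩ : ∃ σ, 1 / t - 1 / p = -σ := ⟨-(1 / t - 1 / p), by ring⟩
  have hσ0 : 0 ≤ σ := by
    have : 1 / t ≤ 1 / p := one_div_le_one_div_of_le hp0 ht
    linarith
  have hLσ : L ^ σ ≠ ∞ := ENNReal.rpow_ne_top_of_nonneg hσ0 hL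
  rw [hσ]
  -- large cubes need `K ^ (1 / p)` only, small ones also the factor `L ^ σ` of the masses
  refine ⟨K ^ (1 / p) * (1 + L ^ σ), ENNReal.mul_ne_top hKp
    (ENNReal.add_ne_top.2 ⟨ENNReal.one_ne_top, hLσ⟩), fun f hf => ⟨fun j m hj => ?_,
    fun k m => ?_⟩⟩
  · have h1 := ENNReal.rpow_le_rpow ((h f hf).1 j m hj) hpinv
    rw [ENNReal.mul_rpow_of_nonneg _ _ hpinv] at h1
    refine (mul_le_mul_right h1 _).trans ?_
    rw [← mul_assoc, mul_comm _ (K ^ (1 / p)), mul_assoc]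
    refine mul_le_mul_left ?_ _
    exact le_mul_of_one_le_right' le_self_add
  · have h1 := ENNReal.rpow_le_rpow ((h f hf).2 k m) hpinv
    rw [ENNReal.mul_rpow_of_nonneg _ _ hpinv, ENNReal.mul_rpow_of_nonneg _ _ hpinv,
      ← ENNReal.rpow_mul] at h1
    have h2 := hmass (-a + k) k m
    rw [add_sub_cancel_right] at h2
    have h20 : (2 : ℝ≥0∞) ^ (k * betaTilde n p D') ≠ 0 :=
      (ENNReal.rpow_pos two_pos ENNReal.ofNat_ne_top).ne'
    have h2t : (2 : ℝ≥0∞) ^ (k * betaTilde n p D') ≠ ∞ :=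
      ENNReal.rpow_ne_top_of_ne_zero two_ne_zero ENNReal.ofNat_ne_top
    have h3 := rpow_mul_le_of_le_mul (mul_ne_zero hL0 h20) (ENNReal.mul_ne_top hL h2t) hσ0 h2
    rw [ENNReal.mul_rpow_of_nonneg _ _ hσ0, ← ENNReal.rpow_mul] at h3
    refine (mul_le_mul' h3 h1).trans ?_
    have e : (k : ℝ) * (D / p - n / p - betaTilde n p D' * -σ)
        = k * betaTilde n p D' * σ + k * (D - n) * (1 / p) := by
      field_simp
      ring
    rw [e, ENNReal.rpow_add _ _ two_ne_zero ENNReal.ofNat_ne_top]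
    have h4 : L ^ σ ≤ 1 + L ^ σ := le_add_self
    refine le_trans (le_of_eq ?_) (mul_le_mul_left (mul_le_mul_left
      (mul_le_mul_right h4 (K ^ (1 / p))) _) _)
    ring

/-- An estimate of the norm, uniform over `L^p_loc(W)`, yields all the properties collected in
`DyadicAverageBounded`. -/
theorem dyadicAverageBounded_of_bmNorm_le (hp : 1 ≤ p) (hW : IsMatrixAp W p) {D : ℝ}
    (hD : HasApDimension W p D) {t : ℝ} {r : ℝ≥0∞} {a : ℤ}
    (h : ∃ C : ℝ≥0, ∀ f ∈ LpLoc W p, bmNorm W p t r (dyadicAverage a f) ≤ C * bmNorm W p t r f) :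
    DyadicAverageBounded W p t r a := by
  obtain ⟨C, hC⟩ := h
  refine ⟨fun f hf m => integrableOn_dyadicCube hp hW hf.1 _ _,
    fun f hf => ⟨dyadicAverage_mem_LpLoc hp hW hD a hf.1, ?_⟩, fun f _ g _ hfg => ?_,
    fun f hf g hg => ?_, fun z f hf => ?_, C, fun f hf => hC f hf.1⟩
  · exact (hC f hf.1).trans_lt (ENNReal.mul_lt_top ENNReal.coe_lt_top hf.2)
  · refine ae_of_all _ fun x => ?_
    rw [dyadicAverage_eq, dyadicAverage_eq]
    exact integral_congr_ae
      (smul_restrict_absolutelyContinuous _ _ hfg)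
  · refine ae_of_all _ fun x => ?_
    rw [Pi.add_apply, dyadicAverage_eq, dyadicAverage_eq, dyadicAverage_eq]
    exact integral_add (Integrable.to_average (integrableOn_dyadicCube hp hW hf.1 _ _))
      (Integrable.to_average (integrableOn_dyadicCube hp hW hg.1 _ _))
  · refine ae_of_all _ fun x => ?_
    rw [Pi.smul_apply, dyadicAverage_eq, dyadicAverage_eq]
    exact integral_smul z _

end Operator

end BourgainMorrey

theorem mainTheorem2 {n d : ℕ} (hn : 1 ≤ n) (hd : 1 ≤ d)
    (W : (Fin n → ℝ) → Matrix (Fin d) (Fin d) ℂ) (p : ℝ) (hp : 1 ≤ p)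
    (hW : BourgainMorrey.IsMatrixAp W p)
    (D : ℝ) (hD0 : 0 ≤ D) (hDn : D < n) (hD : BourgainMorrey.HasApDimension W p D)
    (D' : ℝ)
    (hD' : 1 < p → BourgainMorrey.HasApDimension (BourgainMorrey.dualWeight W p)
      (Real.conjExponent p) D') :
    (∀ t r : ℝ, p < t → t < r →
      -(n * r / p) + D * r / p + n
        - BourgainMorrey.betaTilde n p D' * r * (1 / t - 1 / p) < 0 →
      ∀ a : ℤ, BourgainMorrey.DyadicAverageBounded W p t (ENNReal.ofReal r) a) ∧
    (∀ t : ℝ, p ≤ t →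
      D / p - n / p - BourgainMorrey.betaTilde n p D' * (1 / t - 1 / p) ≤ 0 →
      ∀ a : ℤ, BourgainMorrey.DyadicAverageBounded W p t ⊤ a) := by
  open BourgainMorrey in
  refine ⟨fun t r hpt htr hneg a => ?_, fun t hpt hneg a => ?_⟩
  · obtain ⟨K, hK, h⟩ := exists_bmTerm_dyadicAverage_le hp hW hD hD' hpt.le a
    have hr : 0 < r := by linarith
    have hγ : (D / p - n / p - betaTilde n p D' * (1 / t - 1 / p)) * r + n < 0 := by
      refine lt_of_eq_of_lt ?_ hneg
      ring
    obtain ⟨C, hC⟩ := exists_lrNorm_le hr hγ hK (-a)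
    exact dyadicAverageBounded_of_bmNorm_le hp hW hD
      ⟨C, fun f hf => hC _ _ (h f hf).1 (h f hf).2⟩
  · obtain ⟨K, hK, h⟩ := exists_bmTerm_dyadicAverage_le hp hW hD hD' hpt a
    obtain ⟨C, hC⟩ := exists_lrNorm_top_le (n := n) hneg hK (-a)
    exact dyadicAverageBounded_of_bmNorm_le hp hW hD
      ⟨C, fun f hf => hC _ _ (h f hf).1 (h f hf).2⟩
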